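/- Let $\mathcal{C}$ be a small category. Its Brauer envelope $\mathcal{B}(\mathcal{C})$ is the strict rigid symmetric monoidal category whose objects are the finite sequences of signed objects $X^{+},X^{-}$ ($X\in\mathrm{Ob}(\mathcal{C})$), with tensor product given by concatenation and unit object $\mathbf{1}=\emptyset$ the empty sequence, and whose morphisms are generated under composition and tensor product by: for each morphism $\beta:X\to Y$ of $\mathcal{C}$ the morphisms $\beta_+:X^+\to Y^+$, $\beta_-:Y^-\to X^-$, a cap $X^+\otimes Y^-\to\mathbf{1}$ and a cup $\mathbf{1}\to X^-\otimes Y^+$ (arcs decorated by $\beta$), and the transpositions $X^{\varepsilon_1}\otimes Y^{\varepsilon_2}\to Y^{\varepsilon_2}\otimes X^{\varepsilon_1}$. The relations are: the axioms of a strict monoidal category; the transpositions form a symmetric braiding; the cups and caps decorated by identities satisfy the zigzag (rigidity) identities; and an inner vertex on an arc may be erased, the two adjacent decorations being replaced by their composition in $\mathcal{C}$, while intervals decorated by identities may be erased. Thus morphisms are one-dimensional oriented cobordisms decorated by $\mathcal{C}$. Let $L(\mathcal{C})$ be the set of loops of $\mathcal{C}$: pairs $(X,\beta)$ with $X\in\mathrm{Ob}(\mathcal{C})$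 and $\beta\in\mathrm{End}_{\mathcal{C}}(X)$, modulo the equivalence relation generated by $(X,\gamma\beta)\sim(Y,\beta\gamma)$ for $\beta:X\to Y$, $\gamma:Y\to X$. A closed path $X=X_1\xrightarrow{\beta_1}X_2\to\cdots\to X_n\xrightarrow{\beta_n}X$ in $\mathcal{C}$ determines a decorated circle in $\mathrm{End}_{\mathcal{B}(\mathcal{C})}(\mathbf{1})$. **Proposition.** The monoid $\mathrm{End}_{\mathcal{B}(\mathcal{C})}(\mathbf{1})$ is the free commutative monoid on the set $L(\mathcal{C})$, the circle decorated by $\beta_1,\dots,\beta_n$ being the generator given by the class of $(X,\beta_n\cdots\beta_1)$. Composition of endomorphisms of $\mathbf{1}$ is the disjoint union $f\otimes g$ of diagrams, the empty diagram is the identity endomorphism, and the disjoint union of a finite family of decorated circles corresponds to the sum (multiset) of the classes of its members. -/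

import Mathlib

open CategoryTheory MonoidalCategory

universe v u

/-- A point decorated by an object of `C` and a sign: `pos X` is `X⁺`, `neg X` is `X⁻`. -/
inductive SignedPoint (C : Type u) : Type u
  | pos (X : C) : SignedPoint C
  | neg (X : C) : SignedPoint C

namespace BrauerEnv

open SignedPoint

variable {C : Type u} [Category.{v} C]

/-- Formal diagrams, from a finite sequence of signed points to another: the expressions built by
composition and tensor product from identities, the generators `β₊ : X⁺ ⟶ Y⁺`, `β₋ : Y⁻ ⟶ X⁻`,
the cap `X⁺ ⊗ Y⁻ ⟶ ∅` and the cup `∅ ⟶ X⁻ ⊗ Y⁺` decorated by `β : X ⟶ Y`, and the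
transpositions of two signed points. Composition is written in diagrammatic order. -/
inductive Diag (C : Type u) [Category.{v} C] :
    List (SignedPoint C) → List (SignedPoint C) → Type (max u v)
  | id (S : List (SignedPoint C)) : Diag C S S
  | comp {S T U : List (SignedPoint C)} (f : Diag C S T) (g : Diag C T U) : Diag C S U
  | tensor {S T S' T' : List (SignedPoint C)} (f : Diag C S T) (g : Diag C S' T') :
      Diag C (S ++ S') (T ++ T')
  | plus {X Y : C} (β : X ⟶ Y) : Diag C [pos X] [pos Y]
  | minus {X Y : C} (β : X ⟶ Y) : Diag C [neg Y] [neg X]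
  | cap {X Y : C} (β : X ⟶ Y) : Diag C [pos X, neg Y] []
  | cup {X Y : C} (β : X ⟶ Y) : Diag C [] [neg X, pos Y]
  | swap (a b : SignedPoint C) : Diag C [a, b] [b, a]

namespace Diag

/-- The identity diagram between two equal sequences. -/
def ofEq {S T : List (SignedPoint C)} (h : S = T) : Diag C S T := h ▸ Diag.id S

/-- The signed point `a` crosses the sequence `T` from left to right. -/
def cross (a : SignedPoint C) : (T : List (SignedPoint C)) → Diag C ([a] ++ T) (T ++ [a])
  | [] => Diag.id [a]
  | b :: T => comp (tensor (swap a b) (Diag.id T) :) (tensor (Diag.id [b]) (cross a T) :)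

/-- The permutation diagram that moves the sequence `S` past the sequence `T`, composed of
transpositions. One hexagon identity is the recursion on `S`, the other one the recursion on `T` in
`cross`. -/
def braid : (S T : List (SignedPoint C)) → Diag C (S ++ T) (T ++ S)
  | [], T => ofEq (List.append_nil T).symm
  | a :: S, T =>
      comp (tensor (Diag.id [a]) (braid S T) :) <|
      comp (ofEq (List.append_assoc [a] T S).symm) <|
      comp (tensor (cross a T) (Diag.id S) :) (ofEq (List.append_assoc T [a] S))

end Diag

open Diag

/-- The relations imposed on diagrams: the congruence generated by the axioms of a strict monoidal
category, the axioms making the transpositions a symmetry, the zigzag relations for the cups and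
caps decorated by identities, and the rules by which inner vertices are erased. -/
inductive Rel : {S T : List (SignedPoint C)} → Diag C S T → Diag C S T → Prop
  -- equivalence relation, compatible with composition and tensor product
  | refl {S T} (f : Diag C S T) : Rel f f
  | symm {S T} {f g : Diag C S T} : Rel f g → Rel g f
  | trans {S T} {f g h : Diag C S T} : Rel f g → Rel g h → Rel f h
  | comp {S T U} {f f' : Diag C S T} {g g' : Diag C T U} :
      Rel f f' → Rel g g' → Rel (comp f g) (comp f' g')
  | tensor {S T S' T'} {f f' : Diag C S T} {g g' : Diag C S' T'} :
      Rel f f' → Rel g g' → Rel (tensor f g) (tensor f' g')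
  -- category
  | id_comp {S T} (f : Diag C S T) : Rel (comp (Diag.id S) f) f
  | comp_id {S T} (f : Diag C S T) : Rel (comp f (Diag.id T)) f
  | assoc {S T U V} (f : Diag C S T) (g : Diag C T U) (h : Diag C U V) :
      Rel (comp (comp f g) h) (comp f (comp g h))
  -- strict monoidal category
  | tensor_id (S T : List (SignedPoint C)) :
      Rel (tensor (Diag.id S) (Diag.id T)) (Diag.id (S ++ T))
  | tensor_comp {S T U S' T' U'} (f : Diag C S T) (g : Diag C T U)
      (f' : Diag C S' T') (g' : Diag C T' U') :
      Rel (tensor (comp f g) (comp f' g')) (comp (tensor f f') (tensor g g'))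
  | tensor_assoc {S T S' T' S'' T''} (f : Diag C S T) (g : Diag C S' T') (h : Diag C S'' T'') :
      Rel (comp (tensor (tensor f g) h) (ofEq (List.append_assoc T T' T'')))
        (comp (ofEq (List.append_assoc S S' S'')) (tensor f (tensor g h)))
  | id_tensor {S T} (f : Diag C S T) : Rel (tensor (Diag.id []) f) f
  | tensor_unit {S T} (f : Diag C S T) :
      Rel (comp (tensor f (Diag.id [])) (ofEq (List.append_nil T)))
        (comp (ofEq (List.append_nil S)) f)
  -- symmetry
  | swap_swap (a b : SignedPoint C) : Rel (comp (swap a b) (swap b a)) (Diag.id [a, b])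
  | braid_natural {S T S' T'} (f : Diag C S T) (g : Diag C S' T') :
      Rel (comp (tensor f g) (braid T T')) (comp (braid S S') (tensor g f))
  -- rigidity
  | zigzag_pos (X : C) :
      Rel (comp (Diag.tensor (Diag.id [pos X]) (cup (𝟙 X)) :) (Diag.tensor (cap (𝟙 X)) (Diag.id [pos X]) :))
        (Diag.id [pos X])
  | zigzag_neg (X : C) :
      Rel (comp (Diag.tensor (cup (𝟙 X)) (Diag.id [neg X]) :) (Diag.tensor (Diag.id [neg X]) (cap (𝟙 X)) :))
        (Diag.id [neg X])
  -- erasing inner vertices and intervals decorated by identities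
  | plus_id (X : C) : Rel (plus (𝟙 X)) (Diag.id [pos X])
  | minus_id (X : C) : Rel (minus (𝟙 X)) (Diag.id [neg X])
  | plus_comp {X Y Z : C} (β : X ⟶ Y) (γ : Y ⟶ Z) :
      Rel (comp (plus β) (plus γ)) (plus (β ≫ γ))
  | minus_comp {X Y Z : C} (β : X ⟶ Y) (γ : Y ⟶ Z) :
      Rel (comp (minus γ) (minus β)) (minus (β ≫ γ))
  | plus_cap {X Y Z : C} (β : X ⟶ Y) (γ : Y ⟶ Z) :
      Rel (comp (tensor (plus β) (Diag.id [neg Z])) (cap γ)) (cap (β ≫ γ))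
  | minus_cap {X Y Z : C} (β : X ⟶ Y) (γ : Y ⟶ Z) :
      Rel (comp (tensor (Diag.id [pos X]) (minus γ)) (cap β)) (cap (β ≫ γ))
  | cup_plus {X Y Z : C} (β : X ⟶ Y) (γ : Y ⟶ Z) :
      Rel (comp (cup β) (tensor (Diag.id [neg X]) (plus γ))) (cup (β ≫ γ))
  | cup_minus {X Y Z : C} (β : X ⟶ Y) (γ : Y ⟶ Z) :
      Rel (comp (cup γ) (tensor (minus β) (Diag.id [pos Z]))) (cup (β ≫ γ))

/-- Diagrams up to the relations. -/
instance diagSetoid (S T : List (SignedPoint C)) : Setoid (Diag C S T) :=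
  ⟨Rel, Rel.refl, Rel.symm, Rel.trans⟩

end BrauerEnv

/-- The Brauer envelope of `C`. Its objects are the finite sequences of signed points. -/
@[ext]
structure BrauerEnvelope (C : Type u) : Type u where
  /-- The underlying sequence. -/
  points : List (SignedPoint C)

namespace BrauerEnvelope

open SignedPoint BrauerEnv

variable {C : Type u} [Category.{v} C]

/-- Morphisms of the Brauer envelope are diagrams up to the relations. -/
instance : Category (BrauerEnvelope C) where
  Hom S T := Quotient (diagSetoid (C := C) S.points T.points)
  id S := Quotient.mk _ (Diag.id S.points)
  comp := Quotient.map₂ Diag.comp fun _ _ hf _ _ hg => Rel.comp hf hg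
  id_comp := by rintro S T ⟨f⟩; exact Quotient.sound (Rel.id_comp f)
  comp_id := by rintro S T ⟨f⟩; exact Quotient.sound (Rel.comp_id f)
  assoc := by rintro S T U V ⟨f⟩ ⟨g⟩ ⟨h⟩; exact Quotient.sound (Rel.assoc f g h)

/-- The morphism represented by a diagram. -/
def ofDiag {S T : List (SignedPoint C)} (f : Diag C S T) :
    BrauerEnvelope.mk S ⟶ BrauerEnvelope.mk T :=
  Quotient.mk _ f

theorem ofDiag_sound {S T : List (SignedPoint C)} {f g : Diag C S T} (h : Rel f g) :
    ofDiag f = ofDiag g :=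
  Quotient.sound h

theorem ofDiag_comp {S T U : List (SignedPoint C)} (f : Diag C S T) (g : Diag C T U) :
    ofDiag (Diag.comp f g) = ofDiag f ≫ ofDiag g := rfl

theorem ofDiag_ofEq {S T : List (SignedPoint C)} (h : S = T) :
    ofDiag (Diag.ofEq h) = eqToHom (congrArg BrauerEnvelope.mk h) := by
  subst h; rfl

/-- Juxtaposition of sequences and of diagrams. It is strictly associative and unital on objects,
so the structure isomorphisms are identities (transported along equalities of sequences). -/
instance : MonoidalCategoryStruct (BrauerEnvelope C) where
  tensorObj S T := ⟨S.points ++ T.points⟩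
  tensorUnit := ⟨[]⟩
  tensorHom := Quotient.map₂ Diag.tensor fun _ _ hf _ _ hg => Rel.tensor hf hg
  whiskerLeft S _ _ := Quotient.map (Diag.tensor (Diag.id S.points)) fun _ _ hf =>
    Rel.tensor (Rel.refl _) hf
  whiskerRight f T := Quotient.map (fun f => Diag.tensor f (Diag.id T.points)) (fun _ _ hf =>
    Rel.tensor hf (Rel.refl _)) f
  associator S T U :=
    eqToIso (congrArg BrauerEnvelope.mk (List.append_assoc S.points T.points U.points))
  leftUnitor S := eqToIso (congrArg BrauerEnvelope.mk (List.nil_append S.points))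
  rightUnitor S := eqToIso (congrArg BrauerEnvelope.mk (List.append_nil S.points))

theorem ofDiag_tensor {S T S' T' : List (SignedPoint C)} (f : Diag C S T) (g : Diag C S' T') :
    ofDiag (Diag.tensor f g) = ofDiag f ⊗ₘ ofDiag g := rfl

theorem associator_hom (S T U : BrauerEnvelope C) : (α_ S T U).hom =
    eqToHom (congrArg BrauerEnvelope.mk (List.append_assoc S.points T.points U.points)) := rfl

theorem leftUnitor_hom (S : BrauerEnvelope C) : (λ_ S).hom =
    eqToHom (congrArg BrauerEnvelope.mk (List.nil_append S.points)) := rfl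

theorem rightUnitor_hom (S : BrauerEnvelope C) : (ρ_ S).hom =
    eqToHom (congrArg BrauerEnvelope.mk (List.append_nil S.points)) := rfl

theorem eqToHom_tensorHom_id {S T : BrauerEnvelope C} (h : S = T) (U : BrauerEnvelope C) :
    eqToHom h ⊗ₘ 𝟙 U = eqToHom (congrArg (· ⊗ U) h) := by
  subst h; exact Quotient.sound (Rel.tensor_id _ _)

theorem id_tensorHom_eqToHom {S T : BrauerEnvelope C} (h : S = T) (U : BrauerEnvelope C) :
    𝟙 U ⊗ₘ eqToHom h = eqToHom (congrArg (U ⊗ ·) h) := by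
  subst h; exact Quotient.sound (Rel.tensor_id _ _)

instance : MonoidalCategory (BrauerEnvelope C) :=
  MonoidalCategory.ofTensorHom
    (id_tensorHom_id := fun _ _ => Quotient.sound (Rel.tensor_id _ _))
    (id_tensorHom := by rintro S T U ⟨f⟩; rfl)
    (tensorHom_id := by rintro S T ⟨f⟩ U; rfl)
    (tensorHom_comp_tensorHom := by
      rintro _ _ _ _ _ _ ⟨f⟩ ⟨f'⟩ ⟨g⟩ ⟨g'⟩
      exact (ofDiag_sound (Rel.tensor_comp f g f' g')).symm)
    (associator_naturality := by
      rintro S S' S'' T T' T'' ⟨f⟩ ⟨g⟩ ⟨h⟩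
      have := ofDiag_sound (Rel.tensor_assoc f g h)
      rw [ofDiag_comp, ofDiag_comp, ofDiag_ofEq, ofDiag_ofEq] at this
      exact this)
    (leftUnitor_naturality := by
      rintro S T ⟨f⟩
      have := ofDiag_sound (Rel.id_tensor f)
      exact (Category.comp_id (ofDiag _)).trans (this.trans (Category.id_comp (ofDiag f)).symm))
    (rightUnitor_naturality := by
      rintro S T ⟨f⟩
      have := ofDiag_sound (Rel.tensor_unit f)
      rw [ofDiag_comp, ofDiag_comp, ofDiag_ofEq, ofDiag_ofEq] at this
      exact this)
    (pentagon := fun S T U V => by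
      rw [associator_hom, associator_hom, associator_hom, associator_hom, associator_hom]
      erw [eqToHom_tensorHom_id, id_tensorHom_eqToHom, eqToHom_trans, eqToHom_trans,
        eqToHom_trans])
    (triangle := fun S T => by
      rw [associator_hom, leftUnitor_hom, rightUnitor_hom]
      erw [id_tensorHom_eqToHom, eqToHom_trans, eqToHom_tensorHom_id])

/-- Disjoint union of two closed diagrams, placed side by side. -/
def disjointUnion (f g : End (𝟙_ (BrauerEnvelope C))) : End (𝟙_ (BrauerEnvelope C)) :=
  (λ_ (𝟙_ (BrauerEnvelope C))).inv ≫ (f ⊗ₘ g) ≫ (λ_ (𝟙_ (BrauerEnvelope C))).hom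

/-- A positively oriented strand with inner vertices, whose consecutive edges are decorated by the
composable morphisms of the path. -/
def strand {X : C} : {Y : C} → Quiver.Path X Y → Diag C [pos X] [pos Y]
  | _, .nil => Diag.id [pos X]
  | _, .cons p β => Diag.comp (strand p) (Diag.plus β)

/-- The cap for the opposite orientation. -/
def capOpposite (X : C) : Diag C [neg X, pos X] [] :=
  Diag.comp (Diag.swap (neg X) (pos X)) (Diag.cap (𝟙 X))

/-- The circle whose consecutive edges are decorated by the morphisms of a closed path
`X = X₁ ⟶ X₂ ⟶ ⋯ ⟶ Xₙ ⟶ X` in `C`. -/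
def circle (X : C) (p : Quiver.Path X X) : End (𝟙_ (BrauerEnvelope C)) :=
  ofDiag <| Diag.comp (Diag.cup (𝟙 X)) <|
    Diag.comp (Diag.tensor (Diag.id [neg X]) (strand p)) (capOpposite X)

/-- The disjoint union of a finite family of decorated circles; the empty family gives the empty
diagram. -/
def circles : List (Σ X : C, Quiver.Path X X) → End (𝟙_ (BrauerEnvelope C))
  | [] => ofDiag (Diag.id [])
  | c :: l => disjointUnion (circle c.1 c.2) (circles l)

end BrauerEnvelope

/-- The elementary identification `(X, γβ) ∼ (Y, βγ)` for `β : X ⟶ Y` and `γ : Y ⟶ X`. -/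
inductive LoopRel (C : Type u) [Category.{v} C] : (Σ X : C, End X) → (Σ X : C, End X) → Prop
  | rotate {X Y : C} (β : X ⟶ Y) (γ : Y ⟶ X) : LoopRel C ⟨X, β ≫ γ⟩ ⟨Y, γ ≫ β⟩

/-- The set `L(C)` of loops: pairs of an object and an endomorphism of it, modulo the equivalence
relation generated by the elementary identifications. -/
def LoopSet (C : Type u) [Category.{v} C] : Type (max u v) := Quot (LoopRel C)

/-- The loop of an endomorphism. -/
def LoopSet.mk {C : Type u} [Category.{v} C] (X : C) (β : End X) : LoopSet C :=
  Quot.mk (LoopRel C) ⟨X, β⟩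

/-! The isomorphism sends a closed diagram to the multiset of its loops. One argument shows that
this multiset is well defined, another that it determines the diagram.

Invariance. A diagram `S → T` placed at position `k` acts on configurations of decorated arcs
attached to the positions in `ℕ`, replacing a block of `S.length` positions by one of `T.length`. A
cup adds an arc. A cap joins two arcs, or closes one up and records the class of its decoration in a
multiset. Decorations lie in the semigroup `PartialHom C`, where an absorbing `undef` stands for
undefined composites, and configurations carry no types. Identity diagrams therefore act only as
idempotents, which all other diagrams absorb on both sides (`eval_evalId`, `evalId_eval`). Circles
may be closed at any cap because `loop` is a trace (`loop_mul_comm`). The monoidal and symmetry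
axioms follow from locality: `LocalOp.interchange` and `LocalOp.map_blockPerm`. Hence
`eval_eq_of_rel`. Applying a closed diagram to the empty configuration defines `loops`, and a union
of circles yields the multiset of its classes.

Normal form. Call a morphism from the unit reduced if it is composed of cups, circles and
transpositions. Reduced morphisms are stable under every generator placed at the head of a sequence,
and every diagram is composed of such generators and transpositions. The essential case is a cap
(`IsReduced.capHead`): `HeadSplit` tells whether its two points belong to the last cup, and the cap
then forms a circle, straightens to a decorated strand, or slides past the cup to be treated by
induction. A reduced closed diagram is a union of circles (`exists_eq_circles`).

Circles commute by the interchange law and depend only on the loop class (`circle_comp_comm`), so a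
union of circles is determined by its multiset. This gives injectivity, and surjectivity is clear on
generators. -/

/-! ### Arc configurations and their elementary operations. -/

/-- A configuration of decorated arcs on the set of points `ι`, together with a total of the
closed components: `arcs i = some (j, m)` means that an arc decorated by `m` runs from `i` to `j`. -/
@[ext]
structure ArcState (ι M A : Type*) where
  /-- The arc starting at a point. -/
  arcs : ι → Option (ι × M)
  /-- The closed components. -/
  loops : A

namespace ArcState

variable {ι κ μ M A : Type*} [Semigroup M] [AddCommMonoid A]

/-- Renaming of the points. -/
def map (e : ι ≃ κ) (x : ArcState ι M A) : ArcState κ M A where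
  arcs j := (x.arcs (e.symm j)).map fun q => (e q.1, q.2)
  loops := x.loops

/-- Adding closed components. -/
def addLoops (a : A) (x : ArcState ι M A) : ArcState ι M A := ⟨x.arcs, x.loops + a⟩

/-- Extending the arc that ends at `i`, and erasing it if `m = 0`. -/
def mulEnd [DecidableEq ι] (i : ι) (m : WithZero M) (x : ArcState ι M A) : ArcState ι M A where
  arcs j := (x.arcs j).bind fun q =>
    if q.1 = i then Option.map (fun m => (q.1, q.2 * m)) m else some q
  loops := x.loops

/-- Extending the arc that starts at `i`, and erasing it if `m = 0`. -/
def mulStart [DecidableEq ι] (i : ι) (m : WithZero M) (x : ArcState ι M A) :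
    ArcState ι M A where
  arcs j := if j = i then (x.arcs j).bind fun q => Option.map (fun m => (q.1, m * q.2)) m
    else x.arcs j
  loops := x.loops

/-- Adding a new arc, from the point `inr true` to the point `inr false`. -/
def cup (m : M) (x : ArcState ι M A) : ArcState (ι ⊕ Bool) M A where
  arcs
    | .inl i => (x.arcs i).map fun q => (.inl q.1, q.2)
    | .inr true => some (.inr false, m)
    | .inr false => none
  loops := x.loops

/-- Joining the arc that ends at `inr false` to the arc that starts at `inr true`. -/
def cap (tr : M → A) (m : M) (x : ArcState (ι ⊕ Bool) M A) : ArcState ι M A where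
  arcs i := match x.arcs (.inl i) with
    | some (.inl j, d) => some (j, d)
    | some (.inr false, d) => match x.arcs (.inr true) with
      | some (.inl j, d') => some (j, d * m * d')
      | _ => none
    | _ => none
  loops := match x.arcs (.inr true) with
    | some (.inr false, d) => x.loops + tr (d * m)
    | _ => x.loops

section

omit [Semigroup M] [AddCommMonoid A]

theorem map_map (e : ι ≃ κ) (e' : κ ≃ μ) (x : ArcState ι M A) :
    (x.map e).map e' = x.map (e.trans e') := by
  ext1
  · funext i; simp [map, Function.comp_def]
  · rfl

theorem map_refl (x : ArcState ι M A) : x.map (Equiv.refl ι) = x := by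
  ext1
  · funext i; simp [map]
  · rfl

theorem cup_map (e : ι ≃ κ) (m : M) (x : ArcState ι M A) :
    cup m (x.map e) = (cup m x).map (e.sumCongr (Equiv.refl Bool)) := by
  ext1
  · funext i; rcases i with i | _ | _ <;> simp [map, cup, Function.comp_def]
  · rfl

/-- Exchange of the two pairs of added points. -/
def exchange (ι : Type*) : (ι ⊕ Bool) ⊕ Bool ≃ (ι ⊕ Bool) ⊕ Bool where
  toFun
    | .inl (.inl i) => .inl (.inl i)
    | .inl (.inr b) => .inr b
    | .inr b => .inl (.inr b)
  invFun
    | .inl (.inl i) => .inl (.inl i)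
    | .inl (.inr b) => .inr b
    | .inr b => .inl (.inr b)
  left_inv := by rintro ((_ | _) | _) <;> rfl
  right_inv := by rintro ((_ | _) | _) <;> rfl

theorem cup_cup (m n : M) (x : ArcState ι M A) :
    (cup n (cup m x)).map (exchange ι) = cup m (cup n x) := by
  ext1
  · funext i; rcases i with (i | _ | _) | _ | _ <;>
      simp [map, cup, exchange, Function.comp_def]
  · rfl

end

section mul

variable [DecidableEq ι] [DecidableEq κ]

omit [AddCommMonoid A]

theorem map_mulEnd (e : ι ≃ κ) (i : ι) (m : WithZero M) (x : ArcState ι M A) :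
    (x.mulEnd i m).map e = (x.map e).mulEnd (e i) m := by
  ext1
  · funext j; rcases m with _ | m <;> cases h : x.arcs (e.symm j) <;> simp [map, mulEnd, h] <;>
    split_ifs <;> rfl
  · rfl

theorem map_mulStart (e : ι ≃ κ) (i : ι) (m : WithZero M) (x : ArcState ι M A) :
    (x.mulStart i m).map e = (x.map e).mulStart (e i) m := by
  ext1
  · funext j
    simp only [map, mulStart, Equiv.symm_apply_eq]
    split_ifs <;> rcases m with _ | m <;> cases h : x.arcs (e.symm j) <;> simp
  · rfl

theorem mulEnd_mulEnd (i : ι) (m n : WithZero M) (x : ArcState ι M A) :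
    (x.mulEnd i m).mulEnd i n = x.mulEnd i (m * n) := by
  ext1
  · funext j
    rcases h : x.arcs j with _ | ⟨k, d⟩
    · simp [mulEnd, h]
    · by_cases hk : k = i
      · rcases m with _ | m <;> rcases n with _ | n <;> simp [mulEnd, h, hk]
        · rfl
        · rfl
        · rfl
        · exact congrArg (fun d => some (i, d)) (mul_assoc d m n)
      · simp [mulEnd, h, hk]
  · rfl

theorem mulStart_mulStart (i : ι) (m n : WithZero M) (x : ArcState ι M A) :
    (x.mulStart i m).mulStart i n = x.mulStart i (n * m) := by
  ext1
  · funext j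
    rcases h : x.arcs j with _ | ⟨k, d⟩
    · simp [mulStart, h]
    · by_cases hk : j = i
      · subst hk
        rcases m with _ | m <;> rcases n with _ | n <;> simp [mulStart, h]
        · rfl
        · rfl
        · rfl
        · exact congrArg (fun d => some (k, d)) (mul_assoc n m d).symm
      · simp [mulStart, h, hk]
  · rfl

theorem mulEnd_comm {i j : ι} (hij : i ≠ j) (m n : WithZero M) (x : ArcState ι M A) :
    (x.mulEnd i m).mulEnd j n = (x.mulEnd j n).mulEnd i m := by
  ext1
  · funext k
    rcases m with _ | m <;> rcases n with _ | n <;> rcases h : x.arcs k with _ | ⟨l, d⟩ <;>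
      simp [mulEnd, h] <;> split_ifs <;> simp_all
  · rfl

theorem mulStart_comm {i j : ι} (hij : i ≠ j) (m n : WithZero M) (x : ArcState ι M A) :
    (x.mulStart i m).mulStart j n = (x.mulStart j n).mulStart i m := by
  ext1
  · funext k
    simp only [mulStart]
    split_ifs <;> simp_all
  · rfl

theorem mulEnd_mulStart_comm (i j : ι) (m n : WithZero M) (x : ArcState ι M A) :
    (x.mulEnd i m).mulStart j n = (x.mulStart j n).mulEnd i m := by
  ext1
  · funext k
    rcases m with _ | m <;> rcases n with _ | n <;> rcases h : x.arcs k with _ | ⟨l, d⟩ <;>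
      simp [mulEnd, mulStart, h] <;> split_ifs <;> simp_all [mul_assoc]
  · rfl

theorem cup_mulEnd (i : ι) (m : WithZero M) (n : M) (x : ArcState ι M A) :
    cup n (x.mulEnd i m) = (cup n x).mulEnd (.inl i) m := by
  ext1
  · funext k
    rcases k with k | _ | _ <;> simp [cup, mulEnd]
    rcases m with _ | m <;> cases h : x.arcs k <;> simp <;>
    split_ifs <;> rfl
  · rfl

theorem cup_mulStart (i : ι) (m : WithZero M) (n : M) (x : ArcState ι M A) :
    cup n (x.mulStart i m) = (cup n x).mulStart (.inl i) m := by
  ext1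
  · funext k
    rcases k with k | _ | _ <;> simp [cup, mulStart]
    rcases m with _ | m <;> cases h : x.arcs k <;> simp <;>
    split_ifs <;> rfl
  · rfl

theorem mulEnd_cup (m n : M) (x : ArcState ι M A) :
    (cup m x).mulEnd (.inr false) n = cup (m * n) x := by
  ext1
  · funext k
    rcases k with k | _ | _ <;> simp [cup, mulEnd]
    · cases h : x.arcs k <;> simp
    · rfl
  · rfl

theorem mulStart_cup (m n : M) (x : ArcState ι M A) :
    (cup m x).mulStart (.inr true) n = cup (n * m) x := by
  ext1
  · funext k
    rcases k with k | _ | _ <;> simp [cup, mulStart]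
    rfl
  · rfl

theorem mulEnd_true_cup (m : M) (n : WithZero M) (x : ArcState ι M A) :
    (cup m x).mulEnd (.inr true) n = cup m x := by
  ext1
  · funext k
    rcases k with k | _ | _ <;> simp [cup, mulEnd]
    cases h : x.arcs k <;> simp
  · rfl

theorem mulStart_false_cup (m : M) (n : WithZero M) (x : ArcState ι M A) :
    (cup m x).mulStart (.inr false) n = cup m x := by
  ext1
  · funext k
    rcases k with k | _ | _ <;> simp [cup, mulStart]
  · rfl

end mul

section cap

variable (tr : M → A)

theorem cap_map (e : ι ≃ κ) (m : M) (x : ArcState (ι ⊕ Bool) M A) :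
    cap tr m (x.map (e.sumCongr (Equiv.refl Bool))) = (cap tr m x).map e := by
  ext1
  · funext i
    rcases h : x.arcs (.inl (e.symm i)) with _ | ⟨_ | _ | _, d⟩ <;>
    rcases h' : x.arcs (.inr true) with _ | ⟨_ | _ | _, d'⟩ <;> simp [cap, map, h, h']
  · rcases h' : x.arcs (.inr true) with _ | ⟨_ | _ | _, d'⟩ <;> simp [cap, map, h']

variable [DecidableEq ι]

theorem cap_mulEnd (i : ι) (m : WithZero M) (n : M) (x : ArcState (ι ⊕ Bool) M A) :
    cap tr n (x.mulEnd (.inl i) m) = (cap tr n x).mulEnd i m := by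
  ext1
  · funext j
    rcases m with _ | m <;>
    rcases h : x.arcs (.inl j) with _ | ⟨_ | _ | _, d⟩ <;>
    rcases h' : x.arcs (.inr true) with _ | ⟨_ | _ | _, d'⟩ <;> simp [cap, mulEnd, h, h'] <;>
    split_ifs <;> simp_all [mul_assoc]
  · rcases m with _ | m <;>
    rcases h' : x.arcs (.inr true) with _ | ⟨_ | _ | _, d'⟩ <;> simp [cap, mulEnd, h'] <;>
    split_ifs <;> rfl

theorem cap_mulStart (i : ι) (m : WithZero M) (n : M) (x : ArcState (ι ⊕ Bool) M A) :
    cap tr n (x.mulStart (.inl i) m) = (cap tr n x).mulStart i m := by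
  ext1
  · funext j
    rcases m with _ | m <;>
    rcases h : x.arcs (.inl j) with _ | ⟨_ | _ | _, d⟩ <;>
    rcases h' : x.arcs (.inr true) with _ | ⟨_ | _ | _, d'⟩ <;> simp [cap, mulStart, h, h'] <;>
    split_ifs <;> simp_all [mul_assoc]
  · rcases h' : x.arcs (.inr true) with _ | ⟨_ | _ | _, d'⟩ <;> simp [cap, mulStart, h']

theorem mulEnd_cap (m n : M) (x : ArcState (ι ⊕ Bool) M A) :
    cap tr n (x.mulEnd (.inr false) m) = cap tr (m * n) x := by
  change cap tr n (x.mulEnd (.inr false) (some m)) = _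
  ext1
  · funext j
    rcases h : x.arcs (.inl j) with _ | ⟨_ | _ | _, d⟩ <;>
    rcases h' : x.arcs (.inr true) with _ | ⟨_ | _ | _, d'⟩ <;>
      simp [cap, mulEnd, h, h', mul_assoc]
  · rcases h' : x.arcs (.inr true) with _ | ⟨_ | _ | _, d'⟩ <;>
      simp [cap, mulEnd, h', mul_assoc]

/-- `cap` drops every arc that ends at `inr true`, so erasing such arcs beforehand has no effect. -/
theorem mulEnd_true_cap (n : M) (x : ArcState (ι ⊕ Bool) M A) :
    cap tr n (x.mulEnd (.inr true) 0) = cap tr n x := by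
  change cap tr n (x.mulEnd (.inr true) none) = _
  ext1
  · funext j
    rcases h : x.arcs (.inl j) with _ | ⟨_ | _ | _, d⟩ <;>
    rcases h' : x.arcs (.inr true) with _ | ⟨_ | _ | _, d'⟩ <;>
      simp [cap, mulEnd, h, h']
  · rcases h' : x.arcs (.inr true) with _ | ⟨_ | _ | _, d'⟩ <;>
      simp [cap, mulEnd, h']

/-- `cap` never consults the arc that starts at `inr false`. -/
theorem mulStart_false_cap (m : WithZero M) (n : M) (x : ArcState (ι ⊕ Bool) M A) :
    cap tr n (x.mulStart (.inr false) m) = cap tr n x := by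
  ext1
  · funext j; simp [cap, mulStart]
  · simp [cap, mulStart]

/-- Straightening an arc that ends at `i` and is continued by a cap and a cup. -/
theorem zigzag_end (i : ι) (m n : M) (x : ArcState ι M A) :
    cap tr m ((cup n x).map (Equiv.swap (.inl i) (.inr false))) =
      (x.mulEnd i ↑(m * n)).mulStart i 0 := by
  change _ = (x.mulEnd i (some (m * n))).mulStart i none
  ext1
  · funext j
    by_cases hj : j = i
    · subst hj
      simp [cap, map, cup, mulEnd, mulStart]
    · rw [cap, map]
      have h1 : (Equiv.swap (Sum.inl i) (.inr false) : Equiv.Perm (ι ⊕ Bool)) (.inl j) = .inl j :=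
        Equiv.swap_apply_of_ne_of_ne (by simpa using hj) (by simp)
      have h2 : (Equiv.swap (Sum.inl i) (.inr false) : Equiv.Perm (ι ⊕ Bool)) (.inr true) =
        .inr true := Equiv.swap_apply_of_ne_of_ne (by simp) (by simp)
      rcases h : x.arcs j with _ | ⟨k, d⟩
      · simp [h1, h, cup, mulEnd, mulStart]
      · by_cases hk : k = i
        · subst hk
          simp [h1, h2, h, hj, cup, mulEnd, mulStart, mul_assoc]
        · have h3 : (Equiv.swap (Sum.inl i) (.inr false) : Equiv.Perm (ι ⊕ Bool)) (.inl k) =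
            .inl k := Equiv.swap_apply_of_ne_of_ne (by simpa using hk) (by simp)
          simp [h1, h3, h, hj, hk, cup, mulEnd, mulStart]
  · have h2 : (Equiv.swap (Sum.inl i) (.inr false) : Equiv.Perm (ι ⊕ Bool)) (.inr true) =
      .inr true := Equiv.swap_apply_of_ne_of_ne (by simp) (by simp)
    simp [cap, map, cup, mulEnd, mulStart, h2]

/-- Straightening an arc that starts at `i` and is preceded by a cap and a cup. -/
theorem zigzag_start (i : ι) (m n : M) (x : ArcState ι M A) :
    cap tr m ((cup n x).map (Equiv.swap (.inl i) (.inr true))) =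
      (x.mulStart i ↑(n * m)).mulEnd i 0 := by
  change _ = (x.mulStart i (some (n * m))).mulEnd i none
  have h2 : (Equiv.swap (Sum.inl i) (.inr true) : Equiv.Perm (ι ⊕ Bool)) (.inr false) =
    .inr false := Equiv.swap_apply_of_ne_of_ne (by simp) (by simp)
  have h3 : ∀ k, k ≠ i → (Equiv.swap (Sum.inl i) (.inr true) : Equiv.Perm (ι ⊕ Bool)) (.inl k) =
    .inl k := fun k hk => Equiv.swap_apply_of_ne_of_ne (by simpa using hk) (by simp)
  ext1
  · funext j
    rw [cap, map]
    by_cases hj : j = i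
    · subst hj
      rcases h : x.arcs j with _ | ⟨k, d⟩
      · simp [h2, h, cup, mulEnd, mulStart]
      · by_cases hk : k = j
        · subst hk
          simp [h2, h, cup, mulEnd, mulStart]
        · simp [h2, h3 k hk, h, hk, cup, mulEnd, mulStart]
    · rcases h : x.arcs j with _ | ⟨k, d⟩
      · simp [h3 j hj, h, hj, cup, mulEnd, mulStart]
      · by_cases hk : k = i
        · subst hk
          simp [h3 j hj, h, hj, cup, mulEnd, mulStart]
        · simp [h3 j hj, h3 k hk, h, hj, hk, cup, mulEnd, mulStart]
  · rcases h : x.arcs i with _ | ⟨k, d⟩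
    · simp [cap, map, cup, mulEnd, mulStart, h]
    · by_cases hk : k = i
      · subst hk
        simp [cap, map, cup, mulEnd, mulStart, h]
      · simp [cap, map, cup, mulEnd, mulStart, h, h3 k hk]

variable (htr : ∀ a b, tr (a * b) = tr (b * a))
include htr

theorem mulStart_cap (m n : M) (x : ArcState (ι ⊕ Bool) M A) :
    cap tr n (x.mulStart (.inr true) m) = cap tr (n * m) x := by
  change cap tr n (x.mulStart (.inr true) (some m)) = _
  ext1
  · funext j
    rcases h : x.arcs (.inl j) with _ | ⟨_ | _ | _, d⟩ <;>
    rcases h' : x.arcs (.inr true) with _ | ⟨_ | _ | _, d'⟩ <;>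
      simp [cap, mulStart, h, h', mul_assoc]
  · rcases h' : x.arcs (.inr true) with _ | ⟨_ | _ | _, d'⟩ <;>
      simp [cap, mulStart, h']
    -- The arc closes up: `m` is the first factor on one side and the last on the other, so the
    -- trace property is needed.
    rw [mul_assoc, htr, mul_assoc]

omit [DecidableEq ι]

theorem cap_cap (m n : M) (x : ArcState ((ι ⊕ Bool) ⊕ Bool) M A) :
    cap tr m (cap tr n (x.map (exchange ι))) = cap tr n (cap tr m x) := by
  ext1
  · funext j
    simp only [cap, map, exchange, Equiv.coe_fn_mk, Equiv.coe_fn_symm_mk]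
    generalize x.arcs (.inl (.inl j)) = a, x.arcs (.inl (.inr true)) = b,
      x.arcs (.inr true) = c
    rcases a with _ | ⟨(_ | _ | _) | _ | _, d⟩ <;> try rfl
    all_goals
      rcases b with _ | ⟨(_ | _ | _) | _ | _, d'⟩ <;> try rfl
    all_goals
      rcases c with _ | ⟨(_ | _ | _) | _ | _, d''⟩ <;> try rfl
    all_goals simp [mul_assoc]
  · simp only [cap, map, exchange, Equiv.coe_fn_mk, Equiv.coe_fn_symm_mk]
    generalize x.arcs (.inl (.inr true)) = b, x.arcs (.inr true) = c
    rcases b with _ | ⟨(_ | _ | _) | _ | _, d'⟩ <;>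
    rcases c with _ | ⟨(_ | _ | _) | _ | _, d''⟩ <;> try rfl
    all_goals simp [mul_assoc, add_right_comm]
    -- Here the two caps together close a single circle, and the two orders read its decoration from
    -- different starting points.
    rw [← mul_assoc, htr, mul_assoc]

omit htr

theorem cap_cup (m n : M) (x : ArcState (ι ⊕ Bool) M A) :
    cap tr m ((cup n x).map (exchange ι)) = cup n (cap tr m x) := by
  ext1
  · funext j
    rcases j with j | _ | _ <;>
    rcases h' : x.arcs (.inr true) with _ | ⟨_ | _ | _, d'⟩ <;>
    simp [cap, map, exchange, cup, h'] <;>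
    rcases h : x.arcs (.inl j) with _ | ⟨_ | _ | _, d⟩ <;>
    simp
  · rcases h' : x.arcs (.inr true) with _ | ⟨_ | _ | _, d'⟩ <;>
    simp [cap, map, exchange, cup, h']

theorem cap_cup_self (m n : M) (x : ArcState ι M A) :
    cap tr m (cup n x) = x.addLoops (tr (n * m)) := by
  ext1
  · funext j
    rcases h : x.arcs j with _ | ⟨_, d⟩ <;> simp [cap, cup, addLoops, h]
  · simp [cap, cup, addLoops]

end cap

end ArcState

/-! ### Operations at signed points and at numbered positions. -/

namespace ArcState

variable {ι κ M A : Type*} [Semigroup M] [AddCommMonoid A]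

/-- Extending the arc that ends at `i`, when only arcs that end there are allowed. -/
def endAt [DecidableEq ι] (i : ι) (m : M) (x : ArcState ι M A) : ArcState ι M A :=
  (x.mulEnd i m).mulStart i 0

/-- Extending the arc that starts at `i`, when only arcs that start there are allowed. -/
def startAt [DecidableEq ι] (i : ι) (m : M) (x : ArcState ι M A) : ArcState ι M A :=
  (x.mulStart i m).mulEnd i 0

section

variable [DecidableEq ι] [DecidableEq κ]

omit [AddCommMonoid A]

theorem map_endAt (e : ι ≃ κ) (i : ι) (m : M) (x : ArcState ι M A) :
    (x.endAt i m).map e = (x.map e).endAt (e i) m := by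
  simp only [endAt, map_mulEnd, map_mulStart]

theorem map_startAt (e : ι ≃ κ) (i : ι) (m : M) (x : ArcState ι M A) :
    (x.startAt i m).map e = (x.map e).startAt (e i) m := by
  simp only [startAt, map_mulEnd, map_mulStart]

theorem endAt_endAt (i : ι) (m n : M) (x : ArcState ι M A) :
    (x.endAt i m).endAt i n = x.endAt i (m * n) := by
  simp only [endAt, mulEnd_mulStart_comm, mulEnd_mulEnd, mulStart_mulStart, mul_zero,
    WithZero.coe_mul]

theorem startAt_startAt (i : ι) (m n : M) (x : ArcState ι M A) :
    (x.startAt i m).startAt i n = x.startAt i (n * m) := by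
  simp only [startAt, mulEnd_mulStart_comm, mulEnd_mulEnd, mulStart_mulStart, mul_zero,
    WithZero.coe_mul]

theorem endAt_comm {i j : ι} (h : i ≠ j) (m n : M) (x : ArcState ι M A) :
    (x.endAt i m).endAt j n = (x.endAt j n).endAt i m := by
  simp only [endAt, mulEnd_mulStart_comm, mulEnd_comm h, mulStart_comm h]

theorem startAt_comm {i j : ι} (h : i ≠ j) (m n : M) (x : ArcState ι M A) :
    (x.startAt i m).startAt j n = (x.startAt j n).startAt i m := by
  simp only [startAt, mulEnd_mulStart_comm, mulEnd_comm h, mulStart_comm h]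

theorem endAt_startAt_comm {i j : ι} (h : i ≠ j) (m n : M) (x : ArcState ι M A) :
    (x.endAt i m).startAt j n = (x.startAt j n).endAt i m := by
  simp only [startAt, endAt, mulEnd_mulStart_comm, mulEnd_comm h, mulStart_comm h]

theorem cup_endAt (i : ι) (m n : M) (x : ArcState ι M A) :
    cup n (x.endAt i m) = (cup n x).endAt (.inl i) m := by
  simp only [endAt, cup_mulEnd, cup_mulStart]

theorem cup_startAt (i : ι) (m n : M) (x : ArcState ι M A) :
    cup n (x.startAt i m) = (cup n x).startAt (.inl i) m := by
  simp only [startAt, cup_mulEnd, cup_mulStart]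

theorem endAt_cup (m n : M) (x : ArcState ι M A) :
    (cup m x).endAt (.inr false) n = cup (m * n) x := by
  rw [endAt, mulEnd_cup, mulStart_false_cup]

theorem startAt_cup (m n : M) (x : ArcState ι M A) :
    (cup m x).startAt (.inr true) n = cup (n * m) x := by
  rw [startAt, mulStart_cup, mulEnd_true_cup]

end

section

variable [DecidableEq ι] (tr : M → A)

theorem cap_endAt (i : ι) (m n : M) (x : ArcState (ι ⊕ Bool) M A) :
    cap tr n (x.endAt (.inl i) m) = (cap tr n x).endAt i m := by
  simp only [endAt, cap_mulEnd, cap_mulStart]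

theorem cap_startAt (i : ι) (m n : M) (x : ArcState (ι ⊕ Bool) M A) :
    cap tr n (x.startAt (.inl i) m) = (cap tr n x).startAt i m := by
  simp only [startAt, cap_mulEnd, cap_mulStart]

theorem endAt_cap (m n : M) (x : ArcState (ι ⊕ Bool) M A) :
    cap tr n (x.endAt (.inr false) m) = cap tr (m * n) x := by
  rw [endAt, mulStart_false_cap, mulEnd_cap]

theorem startAt_cap (htr : ∀ a b, tr (a * b) = tr (b * a)) (m n : M)
    (x : ArcState (ι ⊕ Bool) M A) :
    cap tr n (x.startAt (.inr true) m) = cap tr (n * m) x := by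
  rw [startAt, mulEnd_true_cap, mulStart_cap tr htr]

end

/-- Insertion of two positions at `k`, the second one carrying the label `b`. -/
def slot (k : ℕ) (b : Bool) : ℕ ⊕ Bool ≃ ℕ where
  toFun
    | .inl n => if n < k then n else n + 2
    | .inr c => if c = b then k + 1 else k
  invFun n := if n < k then .inl n else if n = k then .inr (!b) else
    if n = k + 1 then .inr b else .inl (n - 2)
  left_inv := by
    rintro (n | c)
    · dsimp only; split_ifs <;> first | omega | simp
    · cases b <;> cases c <;> simp
  right_inv := by
    intro n
    rcases lt_trichotomy n k with h | h | h
    · simp [h]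
    · simp [h]
    · rcases eq_or_ne n (k + 1) with h' | h'
      · simp [h']
      · have h1 : ¬ n < k := by omega
        have h2 : ¬ n - 2 < k := by omega
        simp only [h1, h.ne', h', h2, if_false]
        omega

theorem slot_inl_of_lt {k n : ℕ} (h : n < k) (b : Bool) : slot k b (.inl n) = n := if_pos h

theorem slot_inl_of_le {k n : ℕ} (h : k ≤ n) (b : Bool) : slot k b (.inl n) = n + 2 :=
  if_neg (not_lt.2 h)

/-- Inserting a pair at `p ≤ k` shifts the later insertion point to `k + 2`; `exchange` records that
the two pairs are added in the opposite order. -/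
theorem slot_slot {p k : ℕ} (h : p ≤ k) (b c : Bool) :
    ((slot k c).sumCongr (Equiv.refl Bool)).trans (slot p b) =
      (exchange ℕ).trans (((slot p b).sumCongr (Equiv.refl Bool)).trans (slot (k + 2) c)) := by
  ext ((n | d) | d) <;> simp [slot, exchange] <;> split_ifs <;> omega

/-- The permutation of the positions from `k` on induced by a permutation of `ℕ`. -/
def shiftPerm (k : ℕ) (e : Equiv.Perm ℕ) : Equiv.Perm ℕ where
  toFun n := if n < k then n else k + e (n - k)
  invFun n := if n < k then n else k + e.symm (n - k)
  left_inv n := by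
    rcases lt_or_ge n k with h | h
    · simp [h]
    · simp [not_lt.2 h, h]
  right_inv n := by
    rcases lt_or_ge n k with h | h
    · simp [h]
    · simp [not_lt.2 h, h]

theorem shiftPerm_of_lt {k n : ℕ} (h : n < k) (e : Equiv.Perm ℕ) : shiftPerm k e n = n := if_pos h

theorem shiftPerm_add (k c : ℕ) (e : Equiv.Perm ℕ) :
    shiftPerm (k + c) e = shiftPerm k (shiftPerm c e) := by
  ext n
  simp only [shiftPerm, Equiv.coe_fn_mk]
  split_ifs <;> first | omega | skip
  rw [Nat.sub_add_eq]; omega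

theorem slot_shiftPerm (k : ℕ) (b : Bool) (e : Equiv.Perm ℕ) :
    (slot k b).trans (shiftPerm (k + 2) e) =
      ((shiftPerm k e).sumCongr (Equiv.refl Bool)).trans (slot k b) := by
  ext (n | d)
  · rcases lt_or_ge n k with h | h
    · simp [slot, shiftPerm, h]; omega
    · simp [slot, shiftPerm, not_lt.2 h]; omega
  · simp [slot, shiftPerm]; split_ifs <;> omega

theorem perm_lt_of_fix {k : ℕ} {e : Equiv.Perm ℕ} (he : ∀ n, k ≤ n → e n = n) {n : ℕ}
    (hn : n < k) : e n < k := by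
  by_contra! h
  have := e.injective (he _ h)
  omega

theorem slot_perm {k : ℕ} {e : Equiv.Perm ℕ} (he : ∀ n, k ≤ n → e n = n) (b : Bool) :
    (slot k b).trans e = (e.sumCongr (Equiv.refl Bool)).trans (slot k b) := by
  ext (n | d)
  · rcases lt_or_ge n k with h | h
    · simp [slot, h, perm_lt_of_fix he h]
    · simp [slot, he n h, not_lt.2 h]
      exact he _ (by omega)
  · simp [slot]; split_ifs
    · exact he _ (by omega)
    · exact he _ (by omega)

/-- The permutation exchanging the block of `n` positions at `k` with the next `m` ones. -/
def blockPerm (k n m : ℕ) : Equiv.Perm ℕ where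
  toFun p := if p < k then p else if p < k + n then p + m else if p < k + n + m then p - n else p
  invFun p := if p < k then p else if p < k + m then p + n else if p < k + m + n then p - m else p
  left_inv p := by dsimp only; split_ifs <;> omega
  right_inv p := by dsimp only; split_ifs <;> omega

theorem blockPerm_symm (k n m : ℕ) : (blockPerm k n m).symm = blockPerm k m n := rfl

theorem blockPerm_zero (k m : ℕ) : blockPerm k 0 m = Equiv.refl ℕ := by
  ext p; simp only [blockPerm, Equiv.coe_fn_mk, Equiv.refl_apply]; split_ifs <;> omega

theorem blockPerm_zero_right (k n : ℕ) : blockPerm k n 0 = Equiv.refl ℕ := by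
  ext p; simp only [blockPerm, Equiv.coe_fn_mk, Equiv.refl_apply]; split_ifs <;> omega

/-- A hexagon identity: the right-hand part of the block crosses first. `blockPerm_add_right` is the
other hexagon. -/
theorem blockPerm_add (k n n' m : ℕ) :
    blockPerm k (n + n') m = (blockPerm (k + n) n' m).trans (blockPerm k n m) := by
  ext p; simp only [blockPerm, Equiv.coe_fn_mk, Equiv.trans_apply]; split_ifs <;> omega

theorem blockPerm_add_right (k n m m' : ℕ) :
    blockPerm k n (m + m') = (blockPerm k n m).trans (blockPerm (k + m) n m') := by
  ext p; simp only [blockPerm, Equiv.coe_fn_mk, Equiv.trans_apply]; split_ifs <;> omega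

theorem blockPerm_fix {k n m p : ℕ} (h : k + n + m ≤ p) : blockPerm k n m p = p := by
  simp only [blockPerm, Equiv.coe_fn_mk]; split_ifs <;> omega

theorem shiftPerm_blockPerm (j k n m : ℕ) :
    shiftPerm j (blockPerm k n m) = blockPerm (j + k) n m := by
  ext p; simp only [blockPerm, shiftPerm, Equiv.coe_fn_mk]; split_ifs <;> omega

/-- Moving an inserted pair past `m` positions amounts to inserting it `m` places further on. This
makes cups and caps natural for the braiding. -/
theorem slot_blockPerm (k m : ℕ) (b : Bool) :
    (slot k b).trans (blockPerm k 2 m) = slot (k + m) b := by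
  ext (n | d)
  · simp only [slot, blockPerm, Equiv.coe_fn_mk, Equiv.trans_apply]; split_ifs <;> omega
  · simp only [slot, blockPerm, Equiv.coe_fn_mk, Equiv.trans_apply]; split_ifs <;> omega

/-- The cap at the positions `k` and `k + 1`. -/
def capAt (tr : M → A) (k : ℕ) (m : M) (x : ArcState ℕ M A) : ArcState ℕ M A :=
  cap tr m (x.map (slot k true).symm)

/-- The cup at the positions `k` and `k + 1`. -/
def cupAt (k : ℕ) (m : M) (x : ArcState ℕ M A) : ArcState ℕ M A :=
  (cup m x).map (slot k false)

section

variable (tr : M → A)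

theorem capAt_endAt (k i : ℕ) (m n : M) (x : ArcState ℕ M A) :
    capAt tr k n (x.endAt (slot k true (.inl i)) m) = (capAt tr k n x).endAt i m := by
  rw [capAt, map_endAt, Equiv.symm_apply_apply, cap_endAt, capAt]

theorem capAt_startAt (k i : ℕ) (m n : M) (x : ArcState ℕ M A) :
    capAt tr k n (x.startAt (slot k true (.inl i)) m) = (capAt tr k n x).startAt i m := by
  rw [capAt, map_startAt, Equiv.symm_apply_apply, cap_startAt, capAt]

omit [AddCommMonoid A] in
theorem cupAt_endAt (k i : ℕ) (m n : M) (x : ArcState ℕ M A) :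
    cupAt k n (x.endAt i m) = (cupAt k n x).endAt (slot k false (.inl i)) m := by
  rw [cupAt, cup_endAt, map_endAt, cupAt]

omit [AddCommMonoid A] in
theorem cupAt_startAt (k i : ℕ) (m n : M) (x : ArcState ℕ M A) :
    cupAt k n (x.startAt i m) = (cupAt k n x).startAt (slot k false (.inl i)) m := by
  rw [cupAt, cup_startAt, map_startAt, cupAt]

theorem endAt_capAt (k : ℕ) (m n : M) (x : ArcState ℕ M A) :
    capAt tr k n (x.endAt k m) = capAt tr k (m * n) x := by
  have h : (slot k true).symm k = .inr false := (Equiv.symm_apply_eq _).2 rfl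
  rw [capAt, map_endAt, h, endAt_cap, capAt]

theorem startAt_capAt (htr : ∀ a b, tr (a * b) = tr (b * a)) (k : ℕ) (m n : M)
    (x : ArcState ℕ M A) :
    capAt tr k n (x.startAt (k + 1) m) = capAt tr k (n * m) x := by
  have h : (slot k true).symm (k + 1) = .inr true := (Equiv.symm_apply_eq _).2 rfl
  rw [capAt, map_startAt, h, startAt_cap tr htr, capAt]

omit [AddCommMonoid A] in
theorem endAt_cupAt (k : ℕ) (m n : M) (x : ArcState ℕ M A) :
    (cupAt k m x).endAt (k + 1) n = cupAt k (m * n) x := by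
  rw [cupAt, cupAt, ← endAt_cup, map_endAt]; rfl

omit [AddCommMonoid A] in
theorem startAt_cupAt (k : ℕ) (m n : M) (x : ArcState ℕ M A) :
    (cupAt k m x).startAt k n = cupAt k (n * m) x := by
  rw [cupAt, cupAt, ← startAt_cup, map_startAt]; rfl

theorem capAt_capAt (htr : ∀ a b, tr (a * b) = tr (b * a)) {p k : ℕ} (h : p ≤ k) (m n : M)
    (x : ArcState ℕ M A) :
    capAt tr k n (capAt tr p m x) = capAt tr p m (capAt tr (k + 2) n x) := by
  simp only [capAt]
  rw [← cap_map, ← cap_map, map_map, map_map, ← cap_cap tr htr, map_map]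
  congr 3
  refine Equiv.symm_bijective.injective (Equiv.ext fun z => ?_)
  have := Equiv.ext_iff.1 (slot_slot h true true) (exchange ℕ z)
  simp only [Equiv.symm_trans_apply, Equiv.trans_apply, Equiv.sumCongr_symm, Equiv.refl_symm,
    Equiv.symm_symm] at this ⊢
  rw [show exchange ℕ (exchange ℕ z) = z from (exchange ℕ).symm_apply_apply z] at this
  exact this

omit [Semigroup M] [AddCommMonoid A] in
theorem cupAt_cupAt {p k : ℕ} (h : p ≤ k) (m n : M) (x : ArcState ℕ M A) :
    cupAt (k + 2) n (cupAt p m x) = cupAt p m (cupAt k n x) := by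
  simp only [cupAt]
  rw [cup_map, cup_map, map_map, map_map, slot_slot h, ← cup_cup, map_map]

theorem cupAt_capAt {p k : ℕ} (h : p ≤ k) (m n : M) (x : ArcState ℕ M A) :
    cupAt k n (capAt tr p m x) = capAt tr p m (cupAt (k + 2) n x) := by
  simp only [cupAt, capAt]
  rw [← cap_cup, ← cap_map, cup_map, map_map, map_map, map_map]
  congr 2
  refine Equiv.ext fun z => ?_
  obtain ⟨w, rfl⟩ := ((slot p true).sumCongr (Equiv.refl Bool)).surjective z
  have := Equiv.ext_iff.1 (slot_slot h true false) (exchange ℕ w)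
  simp only [Equiv.trans_apply,
    show exchange ℕ (exchange ℕ w) = w from (exchange ℕ).symm_apply_apply w] at this ⊢
  rw [← this, Equiv.symm_apply_apply,
    show (slot p true).symm.sumCongr (Equiv.refl Bool) =
      ((slot p true).sumCongr (Equiv.refl Bool)).symm from rfl, Equiv.symm_apply_apply]

theorem capAt_cupAt {p k : ℕ} (h : p ≤ k) (m n : M) (x : ArcState ℕ M A) :
    capAt tr (k + 2) n (cupAt p m x) = cupAt p m (capAt tr k n x) := by
  simp only [cupAt, capAt]
  rw [← cap_cup, ← cap_map, cup_map, map_map, map_map, map_map]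
  congr 2
  refine Equiv.ext fun z => ?_
  obtain ⟨w, rfl⟩ := ((slot k true).sumCongr (Equiv.refl Bool)).surjective z
  have := Equiv.ext_iff.1 (slot_slot h false true) w
  simp only [Equiv.trans_apply] at this ⊢
  rw [this, Equiv.symm_apply_apply,
    show (slot k true).symm.sumCongr (Equiv.refl Bool) =
      ((slot k true).sumCongr (Equiv.refl Bool)).symm from rfl, Equiv.symm_apply_apply]

/-- The hypothesis says that `e'` is `e` extended by the identity of the inserted pair. It covers
permutations on either side of the pair, through `slot_shiftPerm` and `slot_perm`. -/
theorem map_capAt {k : ℕ} {m : M} {e e' : Equiv.Perm ℕ}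
    (h : (slot k true).trans e' = (e.sumCongr (Equiv.refl Bool)).trans (slot k true))
    (x : ArcState ℕ M A) : (capAt tr k m x).map e = capAt tr k m (x.map e') := by
  simp only [capAt]
  rw [← cap_map, map_map, map_map]
  congr 2
  refine Equiv.ext fun z => ?_
  obtain ⟨w, rfl⟩ := (slot k true).surjective z
  have := Equiv.ext_iff.1 h w
  simp only [Equiv.trans_apply] at this ⊢
  rw [this, Equiv.symm_apply_apply, Equiv.symm_apply_apply]

omit [Semigroup M] [AddCommMonoid A] in
theorem map_cupAt {k : ℕ} {m : M} {e e' : Equiv.Perm ℕ}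
    (h : (slot k false).trans e' = (e.sumCongr (Equiv.refl Bool)).trans (slot k false))
    (x : ArcState ℕ M A) : (cupAt k m x).map e' = cupAt k m (x.map e) := by
  simp only [cupAt]
  rw [cup_map, map_map, map_map, h]

end

end ArcState

/-! ### Local operations: interchange and naturality of the braiding. -/

namespace ArcState

variable {M A : Type*} [Semigroup M] [AddCommMonoid A]

/-- The operations, at a varying position, that are built from the elementary ones; `LocalOp tr a b`
replaces a block of `a` positions by a block of `b` positions. -/
inductive LocalOp (tr : M → A) : ℕ → ℕ → (ℕ → ArcState ℕ M A → ArcState ℕ M A) → Prop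
  | id (n : ℕ) : LocalOp tr n n fun _ x => x
  | comp {a b c Φ Ψ} : LocalOp tr a b Φ → LocalOp tr b c Ψ → LocalOp tr a c fun k x => Ψ k (Φ k x)
  | left {a b Φ} (c : ℕ) : LocalOp tr a b Φ → LocalOp tr (c + a) (c + b) fun k => Φ (k + c)
  | right {a b Φ} (c : ℕ) : LocalOp tr a b Φ → LocalOp tr (a + c) (b + c) Φ
  | endAt (m : M) : LocalOp tr 1 1 fun k => endAt k m
  | startAt (m : M) : LocalOp tr 1 1 fun k => startAt k m
  | cap (m : M) : LocalOp tr 2 0 fun k => capAt tr k m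
  | cup (m : M) : LocalOp tr 0 2 fun k => cupAt k m
  | swap : LocalOp tr 2 2 fun k => map (blockPerm k 1 1)

namespace LocalOp

variable {tr : M → A} {a b c d : ℕ} {Φ Ψ : ℕ → ArcState ℕ M A → ArcState ℕ M A}

/-- Positions to the right of the block are only translated, so a permutation of them, counted from
the end of the block, passes through the operation. -/
theorem map_shiftPerm (hΦ : LocalOp tr a b Φ) (e : Equiv.Perm ℕ) (k : ℕ) (x : ArcState ℕ M A) :
    (Φ k x).map (shiftPerm (k + b) e) = Φ k (x.map (shiftPerm (k + a) e)) := by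
  induction hΦ generalizing k x e with try dsimp only
  | comp _ _ h1 h2 => rw [h2, h1]
  | left c _ h => rw [← add_assoc, ← add_assoc, h]
  | right c _ h => rw [← add_assoc, ← add_assoc, shiftPerm_add, h, ← shiftPerm_add]
  | endAt m => rw [map_endAt, shiftPerm_of_lt (by omega)]
  | startAt m => rw [map_startAt, shiftPerm_of_lt (by omega)]
  | cap m => exact map_capAt tr (slot_shiftPerm k true e) x
  | cup m => exact map_cupAt (slot_shiftPerm k false e) x
  | swap =>
    rw [map_map, map_map]
    congr 1
    ext p
    simp only [Equiv.trans_apply]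
    rcases lt_or_ge p (k + 2) with h | h
    · rw [shiftPerm_of_lt h, shiftPerm_of_lt]
      simp only [blockPerm, Equiv.coe_fn_mk]; split_ifs <;> omega
    · rw [blockPerm_fix (by omega), blockPerm_fix]
      simp only [shiftPerm, Equiv.coe_fn_mk]; split_ifs <;> omega

/-- Such an `e` moves only positions to the left of the block, which the operation leaves in place.
-/
theorem map_fix (hΦ : LocalOp tr a b Φ) {e : Equiv.Perm ℕ} {k : ℕ} (he : ∀ n, k ≤ n → e n = n)
    (x : ArcState ℕ M A) : (Φ k x).map e = Φ k (x.map e) := by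
  induction hΦ generalizing k x with try dsimp only
  | comp _ _ h1 h2 => rw [h2 he, h1 he]
  | left c _ h => exact h (fun n hn => he n (by omega)) x
  | right c _ h => exact h he x
  | endAt m => rw [map_endAt, he k le_rfl]
  | startAt m => rw [map_startAt, he k le_rfl]
  | cap m => exact map_capAt tr (slot_perm he true) x
  | cup m => exact map_cupAt (slot_perm he false) x
  | swap =>
    rw [map_map, map_map]
    congr 1
    ext p
    simp only [Equiv.trans_apply]
    rcases lt_or_ge p k with h | h
    · have h1 : ∀ q, q < k → blockPerm k 1 1 q = q := fun q hq => if_pos hq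
      rw [h1 p h, h1 _ (perm_lt_of_fix he h)]
    · rw [he p h, he]
      simp only [blockPerm, Equiv.coe_fn_mk]; split_ifs <;> omega

theorem endAt_comm (hΦ : LocalOp tr a b Φ) {p k : ℕ} (hp : p < k) (m : M) (x : ArcState ℕ M A) :
    (Φ k x).endAt p m = Φ k (x.endAt p m) := by
  induction hΦ generalizing k x with try dsimp only
  | comp _ _ h1 h2 => rw [h2 hp, h1 hp]
  | left c _ h => exact h (by omega) x
  | right c _ h => exact h hp x
  | endAt m => exact ArcState.endAt_comm hp.ne' _ _ x
  | startAt m => exact (endAt_startAt_comm hp.ne _ _ x).symm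
  | cap n => rw [← capAt_endAt, slot_inl_of_lt hp]
  | cup n => rw [cupAt_endAt, slot_inl_of_lt hp]
  | swap => rw [map_endAt]; congr 1; exact (if_pos hp).symm

theorem startAt_comm (hΦ : LocalOp tr a b Φ) {p k : ℕ} (hp : p < k) (m : M)
    (x : ArcState ℕ M A) : (Φ k x).startAt p m = Φ k (x.startAt p m) := by
  induction hΦ generalizing k x with try dsimp only
  | comp _ _ h1 h2 => rw [h2 hp, h1 hp]
  | left c _ h => exact h (by omega) x
  | right c _ h => exact h hp x
  | endAt m => exact endAt_startAt_comm hp.ne' _ _ x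
  | startAt m => exact ArcState.startAt_comm hp.ne' _ _ x
  | cap n => rw [← capAt_startAt, slot_inl_of_lt hp]
  | cup n => rw [cupAt_startAt, slot_inl_of_lt hp]
  | swap => rw [map_startAt]; congr 1; exact (if_pos hp).symm

theorem cupAt_comm (hΦ : LocalOp tr a b Φ) {p k : ℕ} (hp : p ≤ k) (m : M)
    (x : ArcState ℕ M A) : Φ (k + 2) (cupAt p m x) = cupAt p m (Φ k x) := by
  induction hΦ generalizing k x with try dsimp only
  | comp _ _ h1 h2 => rw [h1 hp, h2 hp]
  | left c _ h => rw [add_right_comm]; exact h (by omega) x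
  | right c _ h => exact h hp x
  | endAt m => rw [cupAt_endAt, slot_inl_of_le hp]
  | startAt m => rw [cupAt_startAt, slot_inl_of_le hp]
  | cap n => exact capAt_cupAt tr hp _ _ x
  | cup n => exact cupAt_cupAt hp _ _ x
  | swap =>
    refine map_cupAt ?_ x
    ext (n | d) <;> simp only [slot, blockPerm, Equiv.coe_fn_mk, Equiv.trans_apply,
      Equiv.sumCongr_apply, Sum.map_inl, Sum.map_inr, Equiv.refl_apply] <;> split_ifs <;> omega

variable (htr : ∀ m n, tr (m * n) = tr (n * m))
include htr

theorem capAt_comm (hΦ : LocalOp tr a b Φ) {p k : ℕ} (hp : p ≤ k) (m : M)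
    (x : ArcState ℕ M A) : Φ k (capAt tr p m x) = capAt tr p m (Φ (k + 2) x) := by
  induction hΦ generalizing k x with try dsimp only
  | comp _ _ h1 h2 => rw [h1 hp, h2 hp]
  | left c _ h => rw [add_right_comm]; exact h (by omega) x
  | right c _ h => exact h hp x
  | endAt m => rw [← capAt_endAt, slot_inl_of_le hp]
  | startAt m => rw [← capAt_startAt, slot_inl_of_le hp]
  | cap n => exact capAt_capAt tr htr hp _ _ x
  | cup n => exact cupAt_capAt tr hp _ _ x
  | swap =>
    refine map_capAt tr ?_ x
    ext (n | d) <;> simp only [slot, blockPerm, Equiv.coe_fn_mk, Equiv.trans_apply,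
      Equiv.sumCongr_apply, Sum.map_inl, Sum.map_inr, Equiv.refl_apply] <;> split_ifs <;> omega

/-- Induction on `Φ` reduces to elementary operations, each of which commutes with anything placed
to its right. The gap `j` makes the induction work: in the case `right` the idle positions come to
lie between the two blocks. -/
theorem interchange (hΦ : LocalOp tr a b Φ) (hΨ : LocalOp tr c d Ψ) (k j : ℕ)
    (x : ArcState ℕ M A) : Ψ (k + b + j) (Φ k x) = Φ k (Ψ (k + a + j) x) := by
  induction hΦ generalizing k x j with try dsimp only
  | comp _ _ h1 h2 => rw [h2, h1]
  | left c _ h => rw [← add_assoc, ← add_assoc, h]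
  | right c _ h => rw [← add_assoc, ← add_assoc, add_assoc _ c j, h, ← add_assoc]
  | endAt m => exact (hΨ.endAt_comm (by omega) m x).symm
  | startAt m => exact (hΨ.startAt_comm (by omega) m x).symm
  | cap m => rw [add_right_comm k 2]; exact hΨ.capAt_comm htr (by omega) m x
  | cup m => rw [add_right_comm k 2]; exact hΨ.cupAt_comm (by omega) m x
  | swap => exact (hΨ.map_fix (fun n hn => blockPerm_fix (by omega)) x).symm

omit htr

/-- Naturality of the braiding in one variable. For idle positions on the left or right, a hexagon
splits the block permutation, and the factor moving the idle block passes through by `map_fix` or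
`map_shiftPerm`. -/
theorem map_blockPerm (hΦ : LocalOp tr a b Φ) (k m : ℕ) (x : ArcState ℕ M A) :
    (Φ k x).map (blockPerm k b m) = Φ (k + m) (x.map (blockPerm k a m)) := by
  induction hΦ generalizing k x m with try dsimp only
  | comp _ _ h1 h2 => rw [h2, h1]
  | @left a b Φ c hΦ h =>
    rw [blockPerm_add, ← map_map, h, add_right_comm,
      hΦ.map_fix (fun n hn => blockPerm_fix (by omega)), map_map, ← blockPerm_add]
  | @right a b Φ c hΦ h =>
    rw [blockPerm_add, blockPerm_add, ← map_map, ← map_map, ← h]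
    congr 1
    have := hΦ.map_shiftPerm (blockPerm 0 c m) k x
    simpa only [shiftPerm_blockPerm, add_zero] using this
  | endAt n => rw [map_endAt]; congr 1; simp [blockPerm]
  | startAt n => rw [map_startAt]; congr 1; simp [blockPerm]
  | cap n =>
    rw [blockPerm_zero, map_refl]
    simp only [capAt, map_map]
    congr 2
    rw [← slot_blockPerm]
    ext z
    simp
  | cup n =>
    rw [blockPerm_zero, map_refl]
    simp only [cupAt, map_map]
    rw [slot_blockPerm]
  | swap =>
    rw [map_map, map_map]
    congr 1
    ext p
    simp only [blockPerm, Equiv.coe_fn_mk, Equiv.trans_apply]; split_ifs <;> omega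

theorem map_blockPerm_left (hΦ : LocalOp tr a b Φ) (k m : ℕ) (x : ArcState ℕ M A) :
    (Φ (k + m) x).map (blockPerm k m b) = Φ k (x.map (blockPerm k m a)) := by
  have h := hΦ.map_blockPerm k m (x.map (blockPerm k m a))
  have h1 : (blockPerm k m a).trans (blockPerm k a m) = Equiv.refl ℕ := by
    rw [← blockPerm_symm k m a, Equiv.self_trans_symm]
  have h2 : (blockPerm k b m).trans (blockPerm k m b) = Equiv.refl ℕ := by
    rw [← blockPerm_symm k b m, Equiv.self_trans_symm]
  rw [map_map, h1, map_refl] at h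
  rw [← h, map_map, h2, map_refl]

end LocalOp

section

variable (tr : M → A)

/-- The cap takes what ended at `k` together with the start of the new arc at `k + 1`, so the
composite relabelling is the transposition of `zigzag_end`. -/
theorem capAt_cupAt_succ (k : ℕ) (m n : M) (x : ArcState ℕ M A) :
    capAt tr k m (cupAt (k + 1) n x) = x.endAt k (m * n) := by
  rw [capAt, cupAt, map_map, endAt, ← zigzag_end tr]
  congr 2
  refine Equiv.ext fun z => ?_
  rw [Equiv.trans_apply, Equiv.symm_apply_eq, Equiv.swap_apply_def]
  rcases z with p | _ | _ <;> simp [slot] <;>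
    (repeat' split_ifs) <;> simp <;> omega

theorem capAt_succ_cupAt (k : ℕ) (m n : M) (x : ArcState ℕ M A) :
    capAt tr (k + 1) m (cupAt k n x) = x.startAt k (n * m) := by
  rw [capAt, cupAt, map_map, startAt, ← zigzag_start tr]
  congr 2
  refine Equiv.ext fun z => ?_
  rw [Equiv.trans_apply, Equiv.symm_apply_eq, Equiv.swap_apply_def]
  rcases z with p | _ | _ <;> simp [slot] <;>
    (repeat' split_ifs) <;> simp <;> omega

/-- The cup has its start first while the cap expects the end first; after the transposition the
composite relabelling is trivial and the new arc closes on itself. -/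
theorem capAt_swap_cupAt (k : ℕ) (m n : M) (x : ArcState ℕ M A) :
    capAt tr k m ((cupAt k n x).map (blockPerm k 1 1)) = x.addLoops (tr (n * m)) := by
  rw [capAt, cupAt, map_map, map_map, ← cap_cup_self tr]
  congr 1
  convert map_refl (cup n x)
  refine Equiv.ext fun z => ?_
  rw [Equiv.trans_apply, Equiv.trans_apply, Equiv.symm_apply_eq]
  rcases z with p | _ | _ <;> simp [slot, blockPerm] <;> split_ifs <;> omega

end

end ArcState

/-! ### Decorations: a semigroup with a trace. -/

/-- The morphisms of `C`, with an additional element standing for the compositions that are not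
defined. -/
inductive PartialHom (C : Type u) [Category.{v} C] : Type (max u v)
  | undef : PartialHom C
  | of {X Y : C} (β : X ⟶ Y) : PartialHom C

namespace PartialHom

variable {C : Type u} [Category.{v} C]

open scoped Classical in
/-- Composition in diagrammatic order, where it is defined. -/
noncomputable def mul : PartialHom C → PartialHom C → PartialHom C
  | @of _ _ _ Y β, @of _ _ Y' _ γ => if h : Y = Y' then of (β ≫ eqToHom h ≫ γ) else undef
  | _, _ => undef

theorem mul_undef (m : PartialHom C) : mul m undef = undef := by cases m <;> rfl

theorem undef_mul (m : PartialHom C) : mul undef m = undef := by cases m <;> rfl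

theorem mul_of {X Y Z : C} (β : X ⟶ Y) (γ : Y ⟶ Z) : mul (of β) (of γ) = of (β ≫ γ) := by
  simp [mul]

theorem mul_of_ne {X Y Y' Z : C} (h : Y ≠ Y') (β : X ⟶ Y) (γ : Y' ⟶ Z) :
    mul (of β) (of γ) = undef := dif_neg h

/-- There is in general no unit, each object having its own identity; this is why arc configurations
only assume a semigroup. -/
noncomputable instance : Semigroup (PartialHom C) where
  mul := mul
  mul_assoc := by
    change ∀ a b c, mul (mul a b) c = mul a (mul b c)
    rintro (_ | @⟨X, Y, a⟩) (_ | @⟨Y', Z, b⟩) (_ | @⟨Z', W, c⟩) <;>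
      try simp only [mul_undef, undef_mul]
    by_cases h : Y = Y' <;> by_cases h' : Z = Z'
    · subst h h'
      simp only [mul_of, Category.assoc]
    · subst h
      rw [mul_of, mul_of_ne h', mul_of_ne h', mul_undef]
    · subst h'
      rw [mul_of, mul_of_ne h, mul_of_ne h, undef_mul]
    · rw [mul_of_ne h, mul_of_ne h', mul_undef, undef_mul]

theorem of_mul_of {X Y Z : C} (β : X ⟶ Y) (γ : Y ⟶ Z) : of β * of γ = of (β ≫ γ) := mul_of β γ

open scoped Classical in
/-- The loop of an endomorphism, counted with multiplicity one. -/
noncomputable def loop : PartialHom C → Multiset (LoopSet C)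
  | @of _ _ X Y β => if h : Y = X then {LoopSet.mk X (β ≫ eqToHom h)} else 0
  | undef => 0

theorem loop_of {X : C} (β : X ⟶ X) : loop (of β) = {LoopSet.mk X β} := by
  simp [loop]

theorem loop_of_ne {X Y : C} (h : Y ≠ X) (β : X ⟶ Y) : loop (of β) = 0 := dif_neg h

/-- If both composites are defined, this is the elementary rotation of loops. If only one is, it is
not an endomorphism, and both sides vanish. -/
theorem loop_mul_comm (m n : PartialHom C) : loop (m * n) = loop (n * m) := by
  change loop (mul m n) = loop (mul n m)
  rcases m with _ | @⟨X, Y, a⟩ <;> rcases n with _ | @⟨Y', Z, b⟩ <;>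
    try simp only [mul_undef, undef_mul]
  by_cases h : Y = Y' <;> by_cases h' : Z = X
  · subst h h'
    rw [mul_of, mul_of, loop_of, loop_of]
    exact congrArg _ (Quot.sound (LoopRel.rotate a b))
  · subst h
    rw [mul_of, mul_of_ne h', loop_of_ne h']
    rfl
  · subst h'
    rw [mul_of_ne h, mul_of, loop_of_ne h]
    rfl
  · rw [mul_of_ne h, mul_of_ne h']

end PartialHom

/-! ### Evaluation of diagrams and its invariance under the relations. -/

namespace BrauerEnv

open SignedPoint ArcState PartialHom

variable {C : Type u} [Category.{v} C]

/-- The configurations on which diagrams operate. -/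
abbrev LoopState (C : Type u) [Category.{v} C] : Type (max u v) :=
  ArcState ℕ (PartialHom C) (Multiset (LoopSet C))

/-- The operation of the identity of a signed point, which erases ill-typed arcs. -/
noncomputable def evalPoint : SignedPoint C → ℕ → LoopState C → LoopState C
  | pos X, k, x => x.endAt k (of (𝟙 X))
  | neg X, k, x => x.startAt k (of (𝟙 X))

/-- The operation of the identity of a sequence. -/
noncomputable def evalId : List (SignedPoint C) → ℕ → LoopState C → LoopState C
  | [], _, x => x
  | a :: S, k, x => evalId S (k + 1) (evalPoint a k x)

/-- The operation of a diagram on configurations, its source being placed at the position `k`. -/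
noncomputable def eval : {S T : List (SignedPoint C)} → Diag C S T → ℕ → LoopState C → LoopState C
  | _, _, .id S, k, x => evalId S k x
  | _, _, .comp f g, k, x => eval g k (eval f k x)
  | _, _, .tensor (T := T) f g, k, x => eval g (k + T.length) (eval f k x)
  | _, _, .plus β, k, x => x.endAt k (of β)
  | _, _, .minus β, k, x => x.startAt k (of β)
  | _, _, .cap β, k, x => capAt loop k (of β) x
  | _, _, .cup β, k, x => cupAt k (of β) x
  | _, _, .swap a b, k, x => (evalId [a, b] k x).map (blockPerm k 1 1)

theorem localOp_evalPoint (a : SignedPoint C) : LocalOp loop 1 1 (evalPoint a) := by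
  cases a with
  | pos X => exact .endAt _
  | neg X => exact .startAt _

theorem localOp_evalId (S : List (SignedPoint C)) :
    LocalOp loop S.length S.length (evalId S) := by
  induction S with
  | nil => exact .id 0
  | cons a S ih =>
    have := LocalOp.comp ((localOp_evalPoint a).right S.length) (ih.left 1)
    rw [add_comm 1] at this
    exact this

theorem localOp_eval {S T : List (SignedPoint C)} (f : Diag C S T) :
    LocalOp loop S.length T.length (eval f) := by
  induction f with
  | id S => exact localOp_evalId S
  | comp f g hf hg => exact hf.comp hg
  | @tensor S T S' T' f g hf hg =>
    rw [List.length_append, List.length_append]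
    exact (hf.right S'.length).comp (hg.left T.length)
  | plus β => exact .endAt _
  | minus β => exact .startAt _
  | cap β => exact .cap _
  | cup β => exact .cup _
  | swap a b => exact (localOp_evalId [a, b]).comp .swap

theorem eval_interchange {S T S' T' : List (SignedPoint C)} (f : Diag C S T) (g : Diag C S' T')
    (k : ℕ) (x : LoopState C) :
    eval g (k + T.length) (eval f k x) = eval f k (eval g (k + S.length) x) :=
  (localOp_eval f).interchange loop_mul_comm (localOp_eval g) k 0 x

theorem evalId_append (S T : List (SignedPoint C)) (k : ℕ) (x : LoopState C) :
    evalId (S ++ T) k x = evalId T (k + S.length) (evalId S k x) := by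
  induction S generalizing k x with
  | nil => rfl
  | cons a S ih =>
    rw [List.cons_append, evalId, ih, evalId, List.length_cons, add_right_comm, ← add_assoc]

theorem evalPoint_evalPoint (a : SignedPoint C) (k : ℕ) (x : LoopState C) :
    evalPoint a k (evalPoint a k x) = evalPoint a k x := by
  cases a with
  | pos X => simp only [evalPoint, endAt_endAt, of_mul_of, Category.comp_id]
  | neg X => simp only [evalPoint, startAt_startAt, of_mul_of, Category.comp_id]

theorem evalId_evalId (S : List (SignedPoint C)) (k : ℕ) (x : LoopState C) :
    evalId S k (evalId S k x) = evalId S k x := by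
  induction S generalizing k x with
  | nil => rfl
  | cons a S ih =>
    simp only [evalId]
    have := (localOp_evalPoint a).interchange loop_mul_comm (localOp_evalId S) k 0
    simp only [add_zero] at this
    rw [← this, ih, evalPoint_evalPoint]

theorem evalId_blockPerm (S T : List (SignedPoint C)) (k : ℕ) (x : LoopState C) :
    evalId (T ++ S) k (x.map (blockPerm k S.length T.length)) =
      (evalId (S ++ T) k x).map (blockPerm k S.length T.length) := by
  rw [evalId_append, evalId_append, (localOp_evalId T).map_blockPerm_left,
    (localOp_evalId S).map_blockPerm]
  exact (localOp_evalId T).interchange loop_mul_comm (localOp_evalId S) k 0 _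

/-- Replaces the unit law, since `evalId` is only idempotent. Arcs and strands absorb the identities
into their decorations; a transposition carries no decoration, which is why its evaluation includes
the projection `evalId [a, b]`. -/
theorem eval_evalId {S T : List (SignedPoint C)} (f : Diag C S T) (k : ℕ) (x : LoopState C) :
    eval f k (evalId S k x) = eval f k x := by
  induction f generalizing k x with
  | id S => exact evalId_evalId S k x
  | comp f g hf hg => rw [eval, hf, eval]
  | @tensor S T S' T' f g hf hg =>
    have h := eval_interchange f (.id S') k (evalId S k x)
    simp only [eval] at h ⊢
    rw [evalId_append, ← h, hg, hf]
  | plus β => simp only [evalId, evalPoint, eval, endAt_endAt, of_mul_of, Category.id_comp]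
  | minus β => simp only [evalId, evalPoint, eval, startAt_startAt, of_mul_of, Category.comp_id]
  | cap β =>
    simp only [evalId, evalPoint, eval, startAt_capAt loop loop_mul_comm, endAt_capAt, of_mul_of,
      Category.comp_id, Category.id_comp]
  | cup β => rfl
  | swap a b => rw [eval, evalId_evalId, eval]

theorem evalId_eval {S T : List (SignedPoint C)} (f : Diag C S T) (k : ℕ) (x : LoopState C) :
    evalId T k (eval f k x) = eval f k x := by
  induction f generalizing k x with
  | id S => exact evalId_evalId S k x
  | comp f g hf hg => rw [eval, hg]
  | @tensor S T S' T' f g hf hg =>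
    rw [evalId_append, eval, eval_interchange f g, hf, ← eval_interchange f g, hg]
  | plus β => simp only [evalId, evalPoint, eval, endAt_endAt, of_mul_of, Category.comp_id]
  | minus β => simp only [evalId, evalPoint, eval, startAt_startAt, of_mul_of, Category.id_comp]
  | cap β => rfl
  | cup β =>
    simp only [evalId, evalPoint, eval, startAt_cupAt, endAt_cupAt, of_mul_of,
      Category.comp_id, Category.id_comp]
  | swap a b => rw [eval]; exact (evalId_blockPerm [a] [b] k _).trans <| by
                  rw [List.singleton_append, evalId_evalId]; rfl

theorem eval_ofEq {S T : List (SignedPoint C)} (h : S = T) (k : ℕ) (x : LoopState C) :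
    eval (Diag.ofEq h) k x = evalId T k x := by
  subst h; rfl

theorem evalId_swap (a b : SignedPoint C) (T : List (SignedPoint C)) (k : ℕ) (x : LoopState C) :
    evalId (b :: a :: T) k (x.map (blockPerm k 1 1)) =
      (evalId (a :: b :: T) k x).map (blockPerm k 1 1) := by
  have h := evalId_blockPerm [a] [b] k x
  exact (congrArg (evalId T (k + 2)) h).trans
    ((localOp_evalId T).map_fix (fun n hn => blockPerm_fix (by omega)) _).symm

theorem eval_cross (a : SignedPoint C) (T : List (SignedPoint C)) (k : ℕ) (x : LoopState C) :
    eval (Diag.cross a T) k x = (evalId (a :: T) k x).map (blockPerm k 1 T.length) := by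
  induction T generalizing k x with
  | nil =>
    change evalId [a] k x = (evalId [a] k x).map (blockPerm k 1 0)
    rw [blockPerm_zero_right, map_refl]
  | cons b T ih =>
    have h : eval (Diag.tensor (.swap a b) (.id T)) k x =
        (evalId (a :: b :: T) k x).map (blockPerm k 1 1) :=
      ((localOp_evalId T).map_fix (fun n hn => blockPerm_fix (by simp at hn; omega)) _).symm
    rw [Diag.cross, eval, h, eval, ih]
    change (evalId (b :: a :: T) k _).map (blockPerm (k + 1) 1 T.length) = _
    rw [evalId_swap, evalId_evalId, map_map, List.length_cons, add_comm T.length 1,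
      blockPerm_add_right]

/-- The recursion defining `braid` is the hexagon `blockPerm_add`; the projections produced along
the way are absorbed by their neighbours. -/
theorem eval_braid (S T : List (SignedPoint C)) (k : ℕ) (x : LoopState C) :
    eval (Diag.braid S T) k x =
      (evalId (S ++ T) k x).map (blockPerm k S.length T.length) := by
  induction S generalizing k x with
  | nil => rw [Diag.braid, eval_ofEq, List.length_nil, blockPerm_zero, map_refl, List.append_nil,
      List.nil_append]
  | cons a S ih =>
    have h : eval (Diag.tensor (.id [a]) (Diag.braid S T)) k x =
        (evalId (a :: (S ++ T)) k x).map (blockPerm (k + 1) S.length T.length) := ih _ _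
    have h1 := evalId_eval (Diag.tensor (.id [a]) (Diag.braid S T)) k x
    -- The final `ofEq` acts as the projection of the same sequence bracketed otherwise, and the
    -- preceding diagram absorbs it.
    have h2 := (congrArg (evalId · k _) (List.append_assoc T [a] S).symm).trans
      (evalId_eval (Diag.tensor (Diag.cross a T) (.id S)) k
        (eval (Diag.tensor (.id [a]) (Diag.braid S T)) k x))
    rw [h] at h1 h2
    have h4 : eval (Diag.tensor (Diag.cross a T) (.id S)) k
        ((evalId (a :: (S ++ T)) k x).map (blockPerm (k + 1) S.length T.length)) =
        (evalId (a :: (S ++ T)) k x).map (blockPerm k (S.length + 1) T.length) := by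
      rw [eval, eval_cross, eval]
      have h3 := evalId_append (a :: T) S k
        ((evalId (a :: (S ++ T)) k x).map (blockPerm (k + 1) S.length T.length))
      rw [← (localOp_evalId S).map_fix (fun n hn => blockPerm_fix (by simp at hn; omega)),
        show (T ++ [a]).length = (a :: T).length by simp, ← h3]
      refine (congrArg _ h1).trans ?_
      rw [map_map, add_comm S.length, blockPerm_add]
    simp only [Diag.braid]
    rw [eval, eval, eval_ofEq, eval, eval_ofEq, h]
    refine (congrArg (fun y => evalId _ k (eval _ k y)) h1).trans ?_
    exact h2.trans h4

/-- Unit laws come from absorption, functoriality of the tensor product from interchange, braid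
naturality from `map_blockPerm`, rigidity from straightening, and the erasure of vertices from
multiplication of decorations. -/
theorem eval_eq_of_rel {S T : List (SignedPoint C)} {f g : Diag C S T} (h : Rel f g) (k : ℕ)
    (x : LoopState C) : eval f k x = eval g k x := by
  induction h generalizing k x with
  | refl f => rfl
  | symm _ h => exact (h k x).symm
  | trans _ _ h1 h2 => rw [h1, h2]
  | comp _ _ h1 h2 => simp only [eval, h1, h2]
  | tensor _ _ h1 h2 => simp only [eval, h1, h2]
  | id_comp f => exact eval_evalId f k x
  | comp_id f => exact evalId_eval f k x
  | assoc f g h => rfl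
  | tensor_id S T => exact (evalId_append S T k x).symm
  | tensor_comp f g f' g' => simp only [eval, eval_interchange]
  | @tensor_assoc S T S' T' S'' T'' f g h =>
    have h1 := evalId_eval (.tensor f (.tensor g h)) k x
    have h2 := eval_evalId (.tensor f (.tensor g h)) k x
    simp only [eval] at h1 h2
    simp only [eval, eval_ofEq, List.length_append, ← add_assoc, h1, h2]
  | id_tensor f => rfl
  | tensor_unit f =>
    simp only [eval, eval_ofEq, evalId, eval_evalId, evalId_eval]
  | swap_swap a b =>
    simp only [eval]
    rw [evalId_swap, evalId_evalId, map_map]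
    have h := (blockPerm k 1 1).self_trans_symm
    rw [blockPerm_symm] at h
    rw [h, map_refl]
  | @braid_natural S T S' T' f g =>
    have h := evalId_eval (.tensor f g) k x
    have h' := eval_evalId (.tensor g f) k (x.map (blockPerm k S.length S'.length))
    rw [evalId_blockPerm] at h'
    simp only [eval, eval_braid] at h h' ⊢
    rw [h, h', (localOp_eval g).map_blockPerm_left, (localOp_eval f).map_blockPerm,
      eval_interchange]
  | zigzag_pos X =>
    simp only [eval, evalId, evalPoint, List.length_singleton, List.length_nil, add_zero,
      capAt_cupAt_succ, endAt_endAt, of_mul_of, Category.comp_id]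
    rfl
  | zigzag_neg X =>
    -- The projection of the idle strand is slid to the left of the cup, where it sits at `k`.
    have h1 : evalPoint (neg X) (k + 2) (cupAt k (of (𝟙 X)) x) =
      cupAt k (of (𝟙 X)) (evalPoint (neg X) k x) :=
      (localOp_evalPoint (neg X)).cupAt_comm le_rfl _ _
    have h2 : evalPoint (neg X) k (cupAt k (of (𝟙 X)) (evalPoint (neg X) k x)) =
      cupAt k (of (𝟙 X)) (evalPoint (neg X) k x) := by
      simp only [evalPoint, startAt_cupAt, of_mul_of, Category.comp_id]
    change capAt loop (k + 1) _ (evalPoint (neg X) k (evalPoint (neg X) (k + 2)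
      (cupAt k (of (𝟙 X)) x))) =
      evalPoint (neg X) k x
    rw [h1, h2, capAt_succ_cupAt]
    simp only [evalPoint, startAt_startAt, of_mul_of, Category.comp_id]
  | plus_id X => rfl
  | minus_id X => rfl
  | plus_comp β γ => simp only [eval, endAt_endAt, of_mul_of]
  | minus_comp β γ => simp only [eval, startAt_startAt, of_mul_of]
  | plus_cap β γ =>
    simp only [eval, evalId, evalPoint, List.length_singleton, startAt_capAt loop loop_mul_comm,
      endAt_capAt, of_mul_of, Category.comp_id]
  | minus_cap β γ =>
    simp only [eval, evalId, evalPoint, List.length_singleton, startAt_capAt loop loop_mul_comm,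
      endAt_capAt, of_mul_of, Category.id_comp]
  | cup_plus β γ =>
    simp only [eval, evalId, evalPoint, List.length_singleton, startAt_cupAt,
      endAt_cupAt, of_mul_of, Category.id_comp]
  | cup_minus β γ =>
    simp only [eval, evalId, evalPoint, List.length_singleton, startAt_cupAt,
      endAt_cupAt, of_mul_of, Category.comp_id]

end BrauerEnv

/-! ### Evaluation of closed diagrams. -/

namespace BrauerEnvelope

open SignedPoint BrauerEnv ArcState PartialHom

variable {C : Type u} [Category.{v} C]

/-- The operation of a closed diagram, up to the relations. -/
noncomputable def evalClosed (f : End (𝟙_ (BrauerEnvelope C))) :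
    LoopState C → LoopState C :=
  Quotient.lift (s := diagSetoid [] []) (fun d => eval d 0)
    (fun _ _ h => funext fun x => eval_eq_of_rel h 0 x) f

theorem evalClosed_disjointUnion (f g : End (𝟙_ (BrauerEnvelope C))) (x : LoopState C) :
    evalClosed (disjointUnion f g) x = evalClosed g (evalClosed f x) := by
  induction f using Quotient.inductionOn with | _ f
  induction g using Quotient.inductionOn with | _ g
  -- The unitors of the empty sequence are identities, which act trivially.
  rfl

theorem eval_strand {X Y : C} (p : Quiver.Path X Y) (k : ℕ) (x : LoopState C) :
    eval (strand p) k x = x.endAt k (of (composePath p)) := by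
  induction p with
  | nil => rfl
  | cons p β ih => rw [strand, BrauerEnv.eval, ih, BrauerEnv.eval, endAt_endAt, of_mul_of, composePath_cons]

theorem evalClosed_circle (X : C) (p : Quiver.Path X X) (x : LoopState C) :
    evalClosed (circle X p) x = x.addLoops {LoopSet.mk X (composePath p)} := by
  have h1 : evalPoint (neg X) 0 (cupAt 0 (of (𝟙 X)) x) = cupAt 0 (of (𝟙 X)) x := by
    simp only [evalPoint, startAt_cupAt, of_mul_of, Category.comp_id]
  have h2 : evalPoint (neg X) 0 (cupAt 0 (of (composePath p)) x) =
      cupAt 0 (of (composePath p)) x := by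
    simp only [evalPoint, startAt_cupAt, of_mul_of, Category.id_comp]
  have h3 : evalPoint (pos X) (0 + 1) (cupAt 0 (of (composePath p)) x) =
      cupAt 0 (of (composePath p)) x := by
    simp only [evalPoint, endAt_cupAt, of_mul_of, Category.comp_id]
  change capAt loop 0 (of (𝟙 X)) ((evalPoint (pos X) (0 + 1) (evalPoint (neg X) 0
    (eval (strand p) (0 + 1) (evalPoint (neg X) 0 (cupAt 0 (of (𝟙 X)) x))))).map
      (blockPerm 0 1 1)) = _
  rw [h1, eval_strand, endAt_cupAt, of_mul_of, Category.id_comp, h2, h3, capAt_swap_cupAt,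
    of_mul_of, loop_of, Category.comp_id]

theorem evalClosed_circles (l : List (Σ X : C, Quiver.Path X X)) (x : LoopState C) :
    evalClosed (circles l) x = x.addLoops
      (Multiset.ofList (l.map fun c => LoopSet.mk c.1 (composePath c.2))) := by
  induction l generalizing x with
  | nil => exact congrArg (ArcState.mk x.arcs) (add_zero x.loops).symm
  | cons c l ih =>
    rw [circles, evalClosed_disjointUnion, ih, evalClosed_circle]
    refine congrArg (ArcState.mk x.arcs) ?_
    rw [List.map_cons, ← Multiset.cons_coe, ← Multiset.singleton_add, ← add_assoc]
    rfl

end BrauerEnvelope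

/-! ### Calculus of generators at the head of a sequence. -/

namespace BrauerEnvelope

open SignedPoint BrauerEnv

variable {C : Type u} [Category.{v} C]

section strict

variable {S T U S' T' W W' : List (SignedPoint C)} {X Y Z : C}

/-- Juxtaposition with the identity of a signed point on the left. -/
def cons (a : SignedPoint C) (f : mk S ⟶ mk T) : mk (a :: S) ⟶ mk (a :: T) :=
  𝟙 (mk [a]) ⊗ₘ f

/-- Juxtaposition with the identity of a sequence on the right. -/
def head (f : mk S ⟶ mk T) (W : List (SignedPoint C)) : mk (S ++ W) ⟶ mk (T ++ W) :=
  f ⊗ₘ 𝟙 (mk W)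

theorem cons_id (a : SignedPoint C) (S : List (SignedPoint C)) : cons a (𝟙 (mk S)) = 𝟙 (mk (a :: S)) :=
  Quotient.sound (Rel.tensor_id [a] S)

theorem head_id (S W : List (SignedPoint C)) : head (𝟙 (mk S)) W = 𝟙 (mk (S ++ W)) :=
  Quotient.sound (Rel.tensor_id S W)

theorem cons_comp (a : SignedPoint C) (f : mk S ⟶ mk T) (g : mk T ⟶ mk U) :
    cons a (f ≫ g) = cons a f ≫ cons a g := by
  refine Eq.trans ?_ (tensorHom_comp_tensorHom (𝟙 (mk [a])) f (𝟙 (mk [a])) g).symm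
  rw [Category.comp_id]; rfl

theorem head_comp (f : mk S ⟶ mk T) (g : mk T ⟶ mk U) (W : List (SignedPoint C)) :
    head (f ≫ g) W = head f W ≫ head g W := by
  refine Eq.trans ?_ (tensorHom_comp_tensorHom f (𝟙 (mk W)) g (𝟙 (mk W))).symm
  rw [Category.comp_id]; rfl

theorem nil_tensor (f : mk S ⟶ mk T) : (𝟙 (mk []) ⊗ₘ f : mk S ⟶ mk T) = f := by
  induction f using Quotient.inductionOn with | _ f
  exact Quotient.sound (Rel.id_tensor f)

theorem cons_tensor (a : SignedPoint C) (f : mk S ⟶ mk T) (g : mk S' ⟶ mk T') :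
    cons a (S := S ++ S') (T := T ++ T') (f ⊗ₘ g) = (cons a f ⊗ₘ g :) := by
  induction f using Quotient.inductionOn with | _ f
  induction g using Quotient.inductionOn with | _ g
  have := ofDiag_sound (Rel.tensor_assoc (Diag.id [a]) f g)
  rw [ofDiag_comp, ofDiag_comp] at this
  exact ((Category.comp_id _).symm.trans (this.trans (Category.id_comp _))).symm

theorem cons_head (a : SignedPoint C) (f : mk S ⟶ mk T) (W : List (SignedPoint C)) :
    cons a (head f W) = head (cons a f) W := cons_tensor a f (𝟙 (mk W))

theorem cons_tensor_id (a : SignedPoint C) (g : mk S' ⟶ mk T') (S : List (SignedPoint C)) :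
    cons a (S := S ++ S') (T := S ++ T') (𝟙 (mk S) ⊗ₘ g) = (𝟙 (mk (a :: S)) ⊗ₘ g :) := by
  rw [cons_tensor, cons_id]

theorem id_pair_tensor (a b : SignedPoint C) (f : mk S ⟶ mk T) :
    (𝟙 (mk [a, b]) ⊗ₘ f : mk (a :: b :: S) ⟶ mk (a :: b :: T)) = cons a (cons b f) :=
  (cons_tensor_id a f [b]).symm

/-- The interchange law. With a generator as `f`, it lets the generator slide past anything
happening on the tail. -/
theorem head_naturality (f : mk S ⟶ mk T) (g : mk W ⟶ mk W') :
    head f W ≫ (𝟙 (mk T) ⊗ₘ g) = (𝟙 (mk S) ⊗ₘ g) ≫ head f W' := by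
  refine (tensorHom_comp_tensorHom f (𝟙 (mk W)) (𝟙 (mk T)) g).trans ?_
  refine Eq.trans ?_ (tensorHom_comp_tensorHom (𝟙 (mk S)) g f (𝟙 (mk W'))).symm
  simp only [Category.comp_id, Category.id_comp]

/-- Transposition of the first two signed points. -/
def sw (a b : SignedPoint C) (W : List (SignedPoint C)) : mk (a :: b :: W) ⟶ mk (b :: a :: W) :=
  head (ofDiag (Diag.swap a b)) W

/-- Cap of the first two signed points. -/
def capHead (β : X ⟶ Y) (W : List (SignedPoint C)) : mk (pos X :: neg Y :: W) ⟶ mk W :=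
  head (ofDiag (Diag.cap β)) W

/-- Cup inserted at the beginning. -/
def cupHead (β : X ⟶ Y) (W : List (SignedPoint C)) : mk W ⟶ mk (neg X :: pos Y :: W) :=
  head (ofDiag (Diag.cup β)) W

/-- Decoration of the first point, if positive. -/
def plusHead (β : X ⟶ Y) (W : List (SignedPoint C)) : mk (pos X :: W) ⟶ mk (pos Y :: W) :=
  head (ofDiag (Diag.plus β)) W

/-- Decoration of the first point, if negative. -/
def minusHead (β : X ⟶ Y) (W : List (SignedPoint C)) : mk (neg Y :: W) ⟶ mk (neg X :: W) :=
  head (ofDiag (Diag.minus β)) W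

theorem sw_naturality (a b : SignedPoint C) (g : mk W ⟶ mk W') :
    sw a b W ≫ cons b (cons a g) = cons a (cons b g) ≫ sw a b W' := by
  rw [← id_pair_tensor, ← id_pair_tensor]; exact head_naturality _ g

theorem capHead_naturality (β : X ⟶ Y) (g : mk W ⟶ mk W') :
    capHead β W ≫ g = cons _ (cons _ g) ≫ capHead β W' := by
  rw [← id_pair_tensor]
  refine Eq.trans ?_ (head_naturality (ofDiag (Diag.cap β)) g)
  exact congrArg (capHead β W ≫ ·) (nil_tensor g).symm

theorem cupHead_naturality (β : X ⟶ Y) (g : mk W ⟶ mk W') :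
    g ≫ cupHead β W' = cupHead β W ≫ cons _ (cons _ g) := by
  rw [← id_pair_tensor]
  refine Eq.trans ?_ (head_naturality (ofDiag (Diag.cup β)) g).symm
  exact congrArg (· ≫ cupHead β W') (nil_tensor g).symm

theorem plusHead_naturality (β : X ⟶ Y) (g : mk W ⟶ mk W') :
    plusHead β W ≫ cons _ g = cons _ g ≫ plusHead β W' :=
  head_naturality (ofDiag (Diag.plus β)) g

theorem minusHead_naturality (β : X ⟶ Y) (g : mk W ⟶ mk W') :
    minusHead β W ≫ cons _ g = cons _ g ≫ minusHead β W' :=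
  head_naturality (ofDiag (Diag.minus β)) g

theorem sw_sw (a b : SignedPoint C) (W : List (SignedPoint C)) :
    sw a b W ≫ sw b a W = 𝟙 (mk (a :: b :: W)) := by
  rw [sw, sw, ← head_comp, ← ofDiag_comp, ofDiag_sound (Rel.swap_swap a b)]
  exact head_id [a, b] W

theorem tensor_nil (f : mk S ⟶ mk T) : (f ⊗ₘ 𝟙 (mk []) : mk (S ++ []) ⟶ mk (T ++ [])) =
    eqToHom (congrArg mk (List.append_nil S)) ≫ f ≫
      eqToHom (congrArg mk (List.append_nil T).symm) := by
  induction f using Quotient.inductionOn with | _ f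
  have := ofDiag_sound (Rel.tensor_unit f)
  rw [ofDiag_comp, ofDiag_comp, ofDiag_ofEq, ofDiag_ofEq] at this
  have h := congrArg (· ≫ eqToHom (by simp : (mk T : BrauerEnvelope C) = mk (T ++ []))) this
  simp only [Category.assoc, eqToHom_trans, eqToHom_refl, Category.comp_id] at h
  exact h

theorem ofDiag_braid_singleton (a : SignedPoint C) (T : List (SignedPoint C)) :
    ofDiag (Diag.braid [a] T) = ofDiag (Diag.cross a T) := by
  simp only [Diag.braid]
  rw [ofDiag_comp, ofDiag_comp, ofDiag_comp, ofDiag_tensor, ofDiag_ofEq, ofDiag_ofEq, ofDiag_ofEq,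
    ofDiag_tensor]
  have h1 : (ofDiag (Diag.id [a]) ⊗ₘ eqToHom (congrArg mk (List.append_nil T).symm)) =
    eqToHom (congrArg (mk [a] ⊗ ·) (congrArg mk (List.append_nil T).symm)) :=
    id_tensorHom_eqToHom _ _
  erw [h1, tensor_nil]
  simp

theorem cross_nil (a : SignedPoint C) : ofDiag (Diag.cross a []) = 𝟙 (mk [a]) := rfl

theorem cross_cons (a b : SignedPoint C) (T : List (SignedPoint C)) :
    ofDiag (Diag.cross a (b :: T)) = sw a b T ≫ cons b (ofDiag (Diag.cross a T)) := rfl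

theorem head_nil_pair {a b c d : SignedPoint C} (f : mk [a, b] ⟶ mk [c, d]) : head f [] = f :=
  (tensor_nil f).trans (by simp)

theorem cross_singleton (a b : SignedPoint C) :
    ofDiag (Diag.cross a [b]) = ofDiag (Diag.swap a b) := by
  rw [cross_cons, cross_nil, cons_id, Category.comp_id, sw, head_nil_pair]

/-- Naturality of the braiding for a single strand. It yields Yang–Baxter and the rules that carry a
strand across each generator. -/
theorem cross_naturality (a : SignedPoint C) (g : mk S ⟶ mk T) :
    cons a g ≫ ofDiag (Diag.cross a T) = ofDiag (Diag.cross a S) ≫ head g [a] := by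
  induction g using Quotient.inductionOn with | _ g
  have := ofDiag_sound (Rel.braid_natural (Diag.id [a]) g)
  rw [ofDiag_comp, ofDiag_comp, ofDiag_braid_singleton, ofDiag_braid_singleton] at this
  exact this

/-- For explicit `S` and `T` both transports are identities, and this becomes strict associativity.
-/
theorem head_head (f : mk S ⟶ mk T) (V W : List (SignedPoint C)) :
    head (head f V) W = eqToHom (congrArg mk (List.append_assoc S V W)) ≫ head f (V ++ W) ≫
      eqToHom (congrArg mk (List.append_assoc T V W).symm) := by
  induction f using Quotient.inductionOn with | _ f
  have := ofDiag_sound (Rel.tensor_assoc f (Diag.id V) (Diag.id W))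
  rw [ofDiag_comp, ofDiag_comp, ofDiag_ofEq, ofDiag_ofEq] at this
  have h := congrArg (· ≫ eqToHom (congrArg mk (List.append_assoc T V W).symm)) this
  simp only [Category.assoc, eqToHom_trans, eqToHom_refl, Category.comp_id] at h
  refine h.trans ?_
  congr 2
  exact congrArg (fun g => (ofDiag f ⊗ₘ g : mk (S ++ (V ++ W)) ⟶ mk (T ++ (V ++ W))))
    (head_id V W)

/-- Naturality of the crossing of `a` with respect to the transposition of `b` and `c`. -/
theorem yang_baxter (a b c : SignedPoint C) (W : List (SignedPoint C)) :
    sw a b (c :: W) ≫ cons b (sw a c W) ≫ sw b c (a :: W) =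
      cons a (sw b c W) ≫ sw a c (b :: W) ≫ cons c (sw a b W) := by
  have h := congrArg (head · W) (cross_naturality a (ofDiag (Diag.swap b c)))
  simp only [cross_cons, cross_nil, cons_id, Category.comp_id, head_comp, head_head] at h
  simp only [sw, cons_head, head_head] at h ⊢
  simp only [Category.assoc, eqToHom_refl, Category.comp_id, Category.id_comp] at h ⊢
  exact h.symm

/-- Conjugation by a transposition brings the decoration to the head. With its analogues, this
reduces all diagrams to generators at the head. -/
theorem cons_plusHead (a : SignedPoint C) (β : X ⟶ Y) (W : List (SignedPoint C)) :
    cons a (plusHead β W) = sw a (pos X) W ≫ plusHead β (a :: W) ≫ sw (pos Y) a W := by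
  have h := congrArg (head · W) (cross_naturality a (ofDiag (Diag.plus β)))
  simp only [cross_singleton, head_comp, head_head, ← cons_head] at h
  have h' : cons a (plusHead β W) ≫ sw a (pos Y) W = sw a (pos X) W ≫ plusHead β (a :: W) := by
    simpa [sw, plusHead, minusHead] using h
  rw [← Category.assoc, ← h', Category.assoc, sw_sw, Category.comp_id]

theorem cons_minusHead (a : SignedPoint C) (β : X ⟶ Y) (W : List (SignedPoint C)) :
    cons a (minusHead β W) = sw a (neg Y) W ≫ minusHead β (a :: W) ≫ sw (neg X) a W := by
  have h := congrArg (head · W) (cross_naturality a (ofDiag (Diag.minus β)))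
  simp only [cross_singleton, head_comp, head_head, ← cons_head] at h
  have h' : cons a (minusHead β W) ≫ sw a (neg X) W = sw a (neg Y) W ≫ minusHead β (a :: W) := by
    simpa [sw, plusHead, minusHead] using h
  rw [← Category.assoc, ← h', Category.assoc, sw_sw, Category.comp_id]

theorem cons_capHead (a : SignedPoint C) (β : X ⟶ Y) (W : List (SignedPoint C)) :
    cons a (capHead β W) =
      sw a (pos X) (neg Y :: W) ≫ cons (pos X) (sw a (neg Y) W) ≫ capHead β (a :: W) := by
  have h := congrArg (head · W) (cross_naturality a (ofDiag (Diag.cap β)))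
  simp only [cross_cons, cross_nil, cons_id, Category.comp_id, head_comp, head_head,
    ← cons_head] at h
  simpa [sw, capHead, cupHead, head_head, head_id] using h

theorem cons_cupHead (a : SignedPoint C) (β : X ⟶ Y) (W : List (SignedPoint C)) :
    cons a (cupHead β W) ≫ sw a (neg X) (pos Y :: W) ≫ cons (neg X) (sw a (pos Y) W) =
      cupHead β (a :: W) := by
  have h := congrArg (head · W) (cross_naturality a (ofDiag (Diag.cup β)))
  simp only [cross_cons, cross_nil, cons_id, Category.comp_id, head_comp, head_head,
    ← cons_head] at h
  simpa [sw, capHead, cupHead, head_head, head_id] using h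

theorem plusHead_plusHead (β : X ⟶ Y) (γ : Y ⟶ Z) (W : List (SignedPoint C)) :
    plusHead β W ≫ plusHead γ W = plusHead (β ≫ γ) W := by
  rw [plusHead, plusHead, ← head_comp, ← ofDiag_comp, ofDiag_sound (Rel.plus_comp β γ)]; rfl

theorem minusHead_minusHead (β : X ⟶ Y) (γ : Y ⟶ Z) (W : List (SignedPoint C)) :
    minusHead γ W ≫ minusHead β W = minusHead (β ≫ γ) W := by
  rw [minusHead, minusHead, ← head_comp, ← ofDiag_comp, ofDiag_sound (Rel.minus_comp β γ)]; rfl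

theorem plusHead_capHead (β : X ⟶ Y) (γ : Y ⟶ Z) (W : List (SignedPoint C)) :
    plusHead β (neg Z :: W) ≫ capHead γ W = capHead (β ≫ γ) W := by
  have h := congrArg (head · W) (ofDiag_sound (Rel.plus_cap β γ))
  rw [ofDiag_comp, head_comp] at h
  have h' := head_head (ofDiag (Diag.plus β)) [neg Z] W
  simp only [eqToHom_refl, Category.comp_id, Category.id_comp] at h'
  exact (congrArg (· ≫ capHead γ W) h').symm.trans h

theorem cons_minusHead_capHead (β : X ⟶ Y) (γ : Y ⟶ Z) (W : List (SignedPoint C)) :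
    cons (pos X) (minusHead γ W) ≫ capHead β W = capHead (β ≫ γ) W := by
  have h := congrArg (head · W) (ofDiag_sound (Rel.minus_cap β γ))
  rw [ofDiag_comp, head_comp] at h
  exact (congrArg (· ≫ capHead β W) (cons_head _ _ W)).trans h

theorem cupHead_cons_plusHead (β : X ⟶ Y) (γ : Y ⟶ Z) (W : List (SignedPoint C)) :
    cupHead β W ≫ cons (neg X) (plusHead γ W) = cupHead (β ≫ γ) W := by
  have h := congrArg (head · W) (ofDiag_sound (Rel.cup_plus β γ))
  rw [ofDiag_comp, head_comp] at h
  exact (congrArg (cupHead β W ≫ ·) (cons_head _ _ W)).trans h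

theorem cupHead_minusHead (β : X ⟶ Y) (γ : Y ⟶ Z) (W : List (SignedPoint C)) :
    cupHead γ W ≫ minusHead β (pos Z :: W) = cupHead (β ≫ γ) W := by
  have h := congrArg (head · W) (ofDiag_sound (Rel.cup_minus β γ))
  rw [ofDiag_comp, head_comp] at h
  have h' := head_head (ofDiag (Diag.minus β)) [pos Z] W
  simp only [eqToHom_refl, Category.comp_id, Category.id_comp] at h'
  exact (congrArg (cupHead γ W ≫ ·) h').symm.trans h

theorem cons_cupHead_capHead_id (X : C) (W : List (SignedPoint C)) :
    cons (pos X) (cupHead (𝟙 X) W) ≫ capHead (𝟙 X) (pos X :: W) = 𝟙 (mk (pos X :: W)) := by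
  have h := congrArg (head · W) (ofDiag_sound (Rel.zigzag_pos X))
  rw [ofDiag_comp, head_comp] at h
  have h' := head_head (ofDiag (Diag.cap (𝟙 X))) [pos X] W
  simp only [eqToHom_refl, Category.comp_id, Category.id_comp] at h'
  refine Eq.trans ?_ (h.trans (head_id _ W))
  exact congrArg₂ (· ≫ ·) (cons_head _ _ W) h'.symm

theorem cupHead_cons_capHead_id (X : C) (W : List (SignedPoint C)) :
    cupHead (𝟙 X) (neg X :: W) ≫ cons (neg X) (capHead (𝟙 X) W) = 𝟙 (mk (neg X :: W)) := by
  have h := congrArg (head · W) (ofDiag_sound (Rel.zigzag_neg X))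
  rw [ofDiag_comp, head_comp] at h
  have h' := head_head (ofDiag (Diag.cup (𝟙 X))) [neg X] W
  simp only [eqToHom_refl, Category.comp_id, Category.id_comp] at h'
  refine Eq.trans ?_ (h.trans (head_id _ W))
  exact congrArg₂ (· ≫ ·) h'.symm (cons_head _ _ W)

/-- A cup and a cap that form a positive strand. -/
theorem cons_cupHead_capHead (β : X ⟶ Y) (γ : Y ⟶ Z) (W : List (SignedPoint C)) :
    cons (pos X) (cupHead γ W) ≫ capHead β (pos Z :: W) = plusHead (β ≫ γ) W := by
  have h1 : cupHead γ W = cupHead (𝟙 Y) W ≫ cons (neg Y) (plusHead γ W) := by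
    rw [cupHead_cons_plusHead, Category.id_comp]
  have h2 : capHead β (pos Z :: W) = plusHead β (neg Y :: pos Z :: W) ≫ capHead (𝟙 Y) _ := by
    rw [plusHead_capHead, Category.comp_id]
  rw [h2, ← Category.assoc, ← plusHead_naturality, h1, cons_comp, Category.assoc, Category.assoc,
    ← capHead_naturality, ← Category.assoc (cons _ _), cons_cupHead_capHead_id,
    Category.id_comp, plusHead_plusHead]

/-- A cup and a cap that form a negative strand. -/
theorem cupHead_cons_capHead (β : X ⟶ Y) (γ : Y ⟶ Z) (W : List (SignedPoint C)) :
    cupHead β (neg Z :: W) ≫ cons (neg X) (capHead γ W) = minusHead (β ≫ γ) W := by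
  have h1 : capHead γ W = cons (pos Y) (minusHead γ W) ≫ capHead (𝟙 Y) W := by
    rw [cons_minusHead_capHead, Category.id_comp]
  have h2 : cupHead β (neg Z :: W) = cupHead (𝟙 Y) (neg Z :: W) ≫ minusHead β _ := by
    rw [cupHead_minusHead, Category.comp_id]
  rw [h2, Category.assoc, minusHead_naturality, h1, cons_comp, Category.assoc,
    ← Category.assoc (cupHead _ _), ← cupHead_naturality, Category.assoc,
    ← Category.assoc (cupHead _ _), cupHead_cons_capHead_id, Category.id_comp,
    minusHead_minusHead]

/-- A decorated circle, juxtaposed on the left of a sequence. -/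
def loopHead (β : X ⟶ X) (W : List (SignedPoint C)) : mk W ⟶ mk W :=
  head (circle X β.toPath : mk [] ⟶ mk []) W

/-- The decoration `γ` is taken off the cap, moved through the crossing and merged with `β` on the
cup. -/
theorem head_cup_swap_cap (β : X ⟶ Y) (γ : Y ⟶ X) (W : List (SignedPoint C)) :
    cupHead β W ≫ sw (neg X) (pos Y) W ≫ capHead γ W = loopHead (β ≫ γ) W := by
  have h : loopHead (β ≫ γ) W = cupHead (𝟙 X) W ≫ cons (neg X) (plusHead (β ≫ γ) W) ≫
      sw (neg X) (pos X) W ≫ capHead (𝟙 X) W := by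
    have h0 : (circle X (β ≫ γ).toPath : mk [] ⟶ mk []) = ofDiag (Diag.cup (𝟙 X)) ≫
        cons (neg X) (ofDiag (Diag.plus (β ≫ γ))) ≫
        ofDiag (Diag.swap (neg X) (pos X)) ≫ ofDiag (Diag.cap (𝟙 X)) := by
      have h1 := ofDiag_sound (Rel.id_comp (Diag.plus (β ≫ γ)))
      exact congrArg (fun f => ofDiag (Diag.cup (𝟙 X)) ≫ cons (neg X) f ≫
        ofDiag (Diag.swap (neg X) (pos X)) ≫ ofDiag (Diag.cap (𝟙 X))) h1
    rw [loopHead, h0, head_comp, head_comp, head_comp, ← cons_head]; rfl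
  have h1 : capHead γ W = plusHead γ (neg X :: W) ≫ capHead (𝟙 X) W := by
    rw [plusHead_capHead, Category.comp_id]
  have h2 : sw (neg X) (pos Y) W ≫ plusHead γ (neg X :: W) =
      cons (neg X) (plusHead γ W) ≫ sw (neg X) (pos X) W := by
    rw [cons_plusHead, Category.assoc, Category.assoc, sw_sw, Category.comp_id]
  rw [h, h1, ← Category.assoc (sw _ _ _), h2, Category.assoc, ← Category.assoc (cupHead _ _),
    ← Category.assoc (cupHead _ _), cupHead_cons_plusHead, cupHead_cons_plusHead,
    Category.id_comp]

end strict

end BrauerEnvelope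

/-! ### Permutations and their first strand. -/

namespace BrauerEnvelope

open SignedPoint BrauerEnv

variable {C : Type u} [Category.{v} C]

/-- The morphisms composed of transpositions. -/
inductive IsPerm : {S T : List (SignedPoint C)} → (mk S ⟶ mk T) → Prop
  | refl (S : List (SignedPoint C)) : IsPerm (𝟙 (mk S))
  | cons {S T} (a : SignedPoint C) {f : mk S ⟶ mk T} : IsPerm f → IsPerm (cons a f)
  | swap (a b : SignedPoint C) (W : List (SignedPoint C)) : IsPerm (sw a b W)
  | trans {S T U} {f : mk S ⟶ mk T} {g : mk T ⟶ mk U} : IsPerm f → IsPerm g → IsPerm (f ≫ g)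

theorem IsPerm.length_eq {S T : List (SignedPoint C)} {f : mk S ⟶ mk T} (hf : IsPerm f) :
    S.length = T.length := by
  induction hf with
  | refl S => rfl
  | cons a _ h => simp [h]
  | swap a b W => rfl
  | trans _ _ h h' => exact h.trans h'

theorem IsPerm.eq_id {S T : List (SignedPoint C)} {f : mk S ⟶ mk T} (hf : IsPerm f)
    (hS : S = []) (hT : T = []) : f = eqToHom (by rw [hS, hT]) := by
  induction hf with
  | refl S => rfl
  | cons a _ h => simp at hS
  | swap a b W => simp at hS
  | trans hf hg h h' =>
    have h0 := List.eq_nil_of_length_eq_zero (hg.length_eq.trans (by rw [hT]; rfl))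
    rw [h hS h0, h' h0 hT, eqToHom_trans]

/-- A permutation of nonempty sequences either fixes the first strand, or factors so that the two
strands at the first position of the source and of the target cross just once. -/
inductive HeadSplit : {a b : SignedPoint C} → {S T : List (SignedPoint C)} →
    (mk (a :: S) ⟶ mk (b :: T)) → Prop
  | fix {a : SignedPoint C} {S T} (ρ : mk S ⟶ mk T) : IsPerm ρ → HeadSplit (cons a ρ)
  | move {a b : SignedPoint C} {S T D} (σ : mk S ⟶ mk (b :: D)) (τ : mk (a :: D) ⟶ mk T) :
      IsPerm σ → IsPerm τ → HeadSplit (cons a σ ≫ sw a b _ ≫ cons b τ)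

theorem HeadSplit.comp {a b c : SignedPoint C} {S T U : List (SignedPoint C)}
    {f : mk (a :: S) ⟶ mk (b :: T)} {g : mk (b :: T) ⟶ mk (c :: U)}
    (hf : HeadSplit f) (hg : HeadSplit g)
    (h : ∀ {a b : SignedPoint C} {D E : List (SignedPoint C)} (f : mk (a :: D) ⟶ mk (b :: E)),
      IsPerm f → D.length < S.length → HeadSplit f) : HeadSplit (f ≫ g) := by
  cases hf with
  | fix ρ hρ =>
    cases hg with
    | fix ρ' hρ' => rw [← cons_comp]; exact .fix _ (hρ.trans hρ')
    | move σ τ hσ hτ =>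
      rw [← Category.assoc, ← cons_comp]; exact .move _ _ (hρ.trans hσ) hτ
  | move σ τ hσ hτ =>
    cases hg with
    | fix ρ' hρ' =>
      rw [Category.assoc, Category.assoc, ← cons_comp]; exact .move _ _ hσ (hτ.trans hρ')
    | move σ' τ' hσ' hτ' =>
      -- Between the two crossings only a permutation with one strand fewer remains, the one through
      -- `b` being set aside; the induction hypothesis splits it again.
      have h' := h _ (hτ.trans hσ') (by have := hσ.length_eq; simp at this; omega)
      have e : (cons a σ ≫ sw a b _ ≫ cons b τ) ≫ cons b σ' ≫ sw b c _ ≫ cons c τ' =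
          cons a σ ≫ sw a b _ ≫ cons b (τ ≫ σ') ≫ sw b c _ ≫ cons c τ' := by
        simp only [cons_comp, Category.assoc]
      rw [e]
      generalize τ ≫ σ' = ρ at h'
      cases h' with
      | fix ρ hρ =>
        -- The strands `a` and `b` cross twice, and the crossings cancel.
        have e : cons a σ ≫ sw a b _ ≫ cons b (cons a ρ) ≫ sw b a _ ≫ cons a τ' =
            cons a (σ ≫ cons b ρ ≫ τ') := by
          rw [← Category.assoc (sw _ _ _), sw_naturality, Category.assoc,
            ← Category.assoc (sw _ _ _), sw_sw, Category.id_comp, cons_comp, cons_comp]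
        rw [e]
        exact .fix _ (hσ.trans ((hρ.cons b).trans hτ'))
      | move σ₁ τ₁ hσ₁ hτ₁ =>
        -- Three strands cross pairwise, and Yang–Baxter leaves a single crossing of `a` with `c`
        -- between permutations of the rest.
        have e : cons a σ ≫ sw a b _ ≫ cons b (cons a σ₁ ≫ sw a c _ ≫ cons c τ₁) ≫
            sw b c _ ≫ cons c τ' =
            cons a (σ ≫ cons b σ₁ ≫ sw b c _) ≫ sw a c (b :: _) ≫
              cons c (sw a b _ ≫ cons b τ₁ ≫ τ') := by
          simp only [cons_comp, Category.assoc]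
          rw [reassoc_of% (sw_naturality a b σ₁), ← reassoc_of% (sw_naturality b c τ₁),
            reassoc_of% (yang_baxter a b c)]
        rw [e]
        exact .move _ _ (hσ.trans ((hσ₁.cons b).trans (.swap _ _ _)))
          ((IsPerm.swap _ _ _).trans ((hτ₁.cons b).trans hτ'))

theorem IsPerm.headSplit {a b : SignedPoint C} {S T : List (SignedPoint C)}
    {f : mk (a :: S) ⟶ mk (b :: T)} (hf : IsPerm f) : HeadSplit f := by
  obtain ⟨n, hn⟩ : ∃ n, S.length = n := ⟨_, rfl⟩
  induction n using Nat.strong_induction_on generalizing a b S T with | _ n ih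
  -- Induction on `IsPerm` needs free endpoints, so their nonempty form is expressed by equations
  -- and transports.
  have key : ∀ {S' T' : List (SignedPoint C)} {f : mk S' ⟶ mk T'}, IsPerm f →
      ∀ {a b : SignedPoint C} {S T : List (SignedPoint C)} (hS : S' = a :: S) (hT : T' = b :: T),
      S.length = n → HeadSplit (eqToHom (congrArg mk hS.symm) ≫ f ≫ eqToHom (congrArg mk hT)) := by
    intro S' T' f hf
    induction hf with
    | refl S =>
      rintro a b S T rfl hT -
      cases hT
      simpa [cons_id] using HeadSplit.fix (a := a) (𝟙 (mk _)) (.refl _)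
    | cons a hf =>
      rintro a b S T hS hT -
      cases hS; cases hT
      simpa using HeadSplit.fix _ hf
    | swap a b W =>
      rintro a b S T hS hT -
      cases hS; cases hT
      simpa [cons_id] using HeadSplit.move (a := a) (b := b) (𝟙 (mk _)) (𝟙 (mk _)) (.refl _) (.refl _)
    | @trans S₁ T₁ U₁ f g hf hg h h' =>
      rintro a b S T rfl rfl hn
      have hl := hf.length_eq
      cases T₁ with
      | nil => simp at hl
      | cons c U =>
        simp only [List.length_cons, add_left_inj] at hl
        have := (h rfl rfl hn).comp (h' rfl rfl (hl.symm.trans hn)) fun f hf hlt =>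
          ih _ (hn ▸ hlt) hf rfl
        simpa using this
  simpa using key hf rfl rfl hn

/-! ### Stability of reduced morphisms under the generators. -/

/-- The morphisms from the unit that are composed of cups, of circles and of transpositions. -/
inductive IsReduced : {W : List (SignedPoint C)} → (mk [] ⟶ mk W) → Prop
  | nil : IsReduced (𝟙 (mk []))
  | loop {W} {f : mk [] ⟶ mk W} {X : C} (β : X ⟶ X) : IsReduced f → IsReduced (f ≫ loopHead β W)
  | arc {W} {f : mk [] ⟶ mk W} {X Y : C} (β : X ⟶ Y) : IsReduced f → IsReduced (f ≫ cupHead β W)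
  | perm {W W'} {f : mk [] ⟶ mk W} {π : mk W ⟶ mk W'} : IsReduced f → IsPerm π →
      IsReduced (f ≫ π)

theorem loopHead_naturality {X : C} (β : X ⟶ X) {W W' : List (SignedPoint C)} (g : mk W ⟶ mk W') :
    loopHead β W ≫ g = g ≫ loopHead β W' := by
  have h := head_naturality (circle X β.toPath : mk [] ⟶ mk []) g
  rw [nil_tensor] at h
  exact h

/-- Sliding a strand over a cup. -/
theorem cupHead_sw {X Y : C} (β : X ⟶ Y) (a : SignedPoint C) (W : List (SignedPoint C)) :
    cupHead β (a :: W) ≫ cons (neg X) (sw (pos Y) a W) ≫ sw (neg X) a (pos Y :: W) =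
      cons a (cupHead β W) := by
  rw [← cons_cupHead]
  simp only [Category.assoc]
  rw [← Category.assoc (cons (neg X) _) (cons (neg X) _), ← cons_comp, sw_sw, cons_id,
    Category.id_comp, sw_sw, Category.comp_id]

/-- The strand being decorated is traced back through `π`. Either it is the end of the last arc,
whose decoration becomes `γ ≫ β`, or it is older and the last cup slides out of the way. Keeping `π`
arbitrary lets the permutations of the reduced form be absorbed into it. -/
theorem IsReduced.plusHead {W : List (SignedPoint C)} {f : mk [] ⟶ mk W} (hf : IsReduced f)
    {X Y : C} (β : X ⟶ Y) {B : List (SignedPoint C)} {π : mk W ⟶ mk (pos X :: B)}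
    (hπ : IsPerm π) : IsReduced (f ≫ π ≫ plusHead β B) := by
  induction hf generalizing B with
  | nil => have := hπ.length_eq; simp at this
  | loop γ hf h =>
    rw [Category.assoc, loopHead_naturality, ← Category.assoc]
    exact (h hπ).loop γ
  | @arc W f U V γ hf h =>
    -- The first point of the cup is negative and cannot arrive at `pos X`, so the case `fix` does
    -- not occur.
    cases hπ.headSplit with
    | move σ τ hσ hτ =>
      cases hσ.headSplit with
      | fix ρ hρ =>
        have e : (f ≫ cupHead γ W) ≫ (cons (neg U) (cons (pos X) ρ) ≫ sw (neg U) (pos X) _ ≫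
            cons (pos X) τ) ≫ BrauerEnvelope.plusHead β B =
            ((f ≫ ρ) ≫ cupHead (γ ≫ β) _) ≫ sw (neg U) (pos Y) _ ≫ cons (pos Y) τ := by
          simp only [Category.assoc]
          rw [← plusHead_naturality, ← cupHead_cons_plusHead, cons_plusHead]
          simp only [Category.assoc]
          rw [← Category.assoc (sw (pos Y) _ _), sw_sw, Category.id_comp,
            ← Category.assoc ρ, cupHead_naturality, Category.assoc]
        rw [e]
        exact ((hf.perm hρ).arc _).perm ((IsPerm.swap _ _ _).trans (hτ.cons _))
      | move σ₁ τ₁ hσ₁ hτ₁ =>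
        have e : (f ≫ cupHead γ W) ≫ (cons (neg U) (cons (pos V) σ₁ ≫ sw (pos V) (pos X) _ ≫
            cons (pos X) τ₁) ≫ sw (neg U) (pos X) _ ≫ cons (pos X) τ) ≫
              BrauerEnvelope.plusHead β B =
            ((f ≫ σ₁ ≫ BrauerEnvelope.plusHead β _) ≫ cupHead γ (pos Y :: _)) ≫
              cons (neg U) (sw (pos V) (pos Y) _) ≫ sw (neg U) (pos Y) (pos V :: _) ≫
                cons (pos Y) (cons (neg U) τ₁ ≫ τ) := by
          simp only [Category.assoc, cons_comp]
          rw [← reassoc_of% (cupHead_naturality γ σ₁),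
            ← reassoc_of% (sw_naturality (neg U) (pos X) τ₁),
            reassoc_of% (cupHead_sw γ (pos X)), reassoc_of% (cupHead_sw γ (pos Y)),
            ← plusHead_naturality, ← reassoc_of% (plusHead_naturality β (cons (neg U) τ₁)),
            ← reassoc_of% (plusHead_naturality β (cupHead γ _))]
        rw [e]
        exact ((h hσ₁).arc _).perm (((IsPerm.swap _ _ _).cons _).trans
          ((IsPerm.swap _ _ _).trans (((hτ₁.cons _).trans hτ).cons _)))
  | @perm W W' f ρ hf hρ h =>
    have := h (hρ.trans hπ)
    simpa only [Category.assoc] using this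

theorem IsReduced.minusHead {W : List (SignedPoint C)} {f : mk [] ⟶ mk W} (hf : IsReduced f)
    {X Y : C} (β : X ⟶ Y) {B : List (SignedPoint C)} {π : mk W ⟶ mk (neg Y :: B)}
    (hπ : IsPerm π) : IsReduced (f ≫ π ≫ minusHead β B) := by
  induction hf generalizing B with
  | nil => have := hπ.length_eq; simp at this
  | loop γ hf h =>
    rw [Category.assoc, loopHead_naturality, ← Category.assoc]
    exact (h hπ).loop γ
  | @arc W f U V γ hf h =>
    cases hπ.headSplit with
    | fix ρ hρ =>
      have e : (f ≫ cupHead γ W) ≫ cons (neg Y) ρ ≫ BrauerEnvelope.minusHead β B =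
          (f ≫ cupHead (β ≫ γ) W) ≫ cons (neg X) ρ := by
        simp only [Category.assoc]
        rw [← minusHead_naturality, ← cupHead_minusHead, Category.assoc]
      rw [e]
      exact (hf.arc _).perm (hρ.cons _)
    | move σ τ hσ hτ =>
      cases hσ.headSplit with
      | move σ₁ τ₁ hσ₁ hτ₁ =>
        have e : (f ≫ cupHead γ W) ≫ (cons (neg U) (cons (pos V) σ₁ ≫ sw (pos V) (neg Y) _ ≫
            cons (neg Y) τ₁) ≫ sw (neg U) (neg Y) _ ≫ cons (neg Y) τ) ≫
              BrauerEnvelope.minusHead β B =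
            ((f ≫ σ₁ ≫ BrauerEnvelope.minusHead β _) ≫ cupHead γ (neg X :: _)) ≫
              cons (neg U) (sw (pos V) (neg X) _) ≫ sw (neg U) (neg X) (pos V :: _) ≫
                cons (neg X) (cons (neg U) τ₁ ≫ τ) := by
          simp only [Category.assoc, cons_comp]
          rw [← reassoc_of% (cupHead_naturality γ σ₁),
            ← reassoc_of% (sw_naturality (neg U) (neg Y) τ₁),
            reassoc_of% (cupHead_sw γ (neg Y)), reassoc_of% (cupHead_sw γ (neg X)),
            ← minusHead_naturality, ← reassoc_of% (minusHead_naturality β (cons (neg U) τ₁)),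
            ← reassoc_of% (minusHead_naturality β (cupHead γ _))]
        rw [e]
        exact ((h hσ₁).arc _).perm (((IsPerm.swap _ _ _).cons _).trans
          ((IsPerm.swap _ _ _).trans (((hτ₁.cons _).trans hτ).cons _)))
  | @perm W W' f ρ hf hρ h =>
    have := h (hρ.trans hπ)
    simpa only [Category.assoc] using this

/-- Four cases, according to which capped points belong to the last arc: both give a circle; only
the positive one straightens to a negative strand decorated by `γ ≫ β`; only the negative one to a
positive strand decorated by `β ≫ γ`; neither lets the cap precede the cup. -/
theorem IsReduced.capHead {W : List (SignedPoint C)} {f : mk [] ⟶ mk W} (hf : IsReduced f)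
    {X Y : C} (β : X ⟶ Y) {B : List (SignedPoint C)} {π : mk W ⟶ mk (pos X :: neg Y :: B)}
    (hπ : IsPerm π) : IsReduced (f ≫ π ≫ capHead β B) := by
  induction hf generalizing B with
  | nil => have := hπ.length_eq; simp at this
  | loop γ hf h =>
    rw [Category.assoc, loopHead_naturality, ← Category.assoc]
    exact (h hπ).loop γ
  | @arc W f U V γ hf h =>
    cases hπ.headSplit with
    | move σ τ hσ hτ =>
      cases hσ.headSplit with
      | fix ρ hρ =>
        cases hτ.headSplit with
        | fix ρ' hρ' =>
          have e : (f ≫ cupHead γ W) ≫ (cons (neg Y) (cons (pos X) ρ) ≫ sw (neg Y) (pos X) _ ≫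
              cons (pos X) (cons (neg Y) ρ')) ≫ BrauerEnvelope.capHead β B =
              (f ≫ ρ ≫ ρ') ≫ loopHead (γ ≫ β) _ := by
            simp only [Category.assoc]
            rw [← reassoc_of% (cupHead_naturality γ ρ), ← capHead_naturality,
              reassoc_of% (head_cup_swap_cap γ β), loopHead_naturality]
          rw [e]
          exact (hf.perm (hρ.trans hρ')).loop _
        | move σ' τ' hσ' hτ' =>
          have e : (f ≫ cupHead γ W) ≫ (cons (neg U) (cons (pos X) ρ) ≫ sw (neg U) (pos X) _ ≫
              cons (pos X) (cons (neg U) σ' ≫ sw (neg U) (neg Y) _ ≫ cons (neg Y) τ')) ≫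
                BrauerEnvelope.capHead β B =
              (f ≫ (ρ ≫ σ') ≫ BrauerEnvelope.minusHead (γ ≫ β) _) ≫ τ' := by
            simp only [Category.assoc, cons_comp]
            rw [← capHead_naturality, reassoc_of% (sw_naturality (neg U) (pos X) σ'),
              ← reassoc_of% (cons_capHead (neg U) β),
              ← reassoc_of% (cupHead_naturality γ ρ), ← reassoc_of% (cupHead_naturality γ σ'),
              reassoc_of% (cupHead_cons_capHead γ β)]
          rw [e]
          exact (hf.minusHead _ (hρ.trans hσ')).perm hτ'
      | move σ₁ τ₁ hσ₁ hτ₁ =>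
        cases hτ.headSplit with
        | fix ρ' hρ' =>
          have e : (f ≫ cupHead γ W) ≫ (cons (neg Y) (cons (pos V) σ₁ ≫ sw (pos V) (pos X) _ ≫
              cons (pos X) τ₁) ≫ sw (neg Y) (pos X) _ ≫ cons (pos X) (cons (neg Y) ρ')) ≫
                BrauerEnvelope.capHead β B =
              (f ≫ σ₁ ≫ BrauerEnvelope.plusHead (β ≫ γ) _) ≫ τ₁ ≫ ρ' := by
            simp only [Category.assoc, cons_comp]
            rw [← capHead_naturality, ← reassoc_of% (cupHead_naturality γ σ₁),
              ← reassoc_of% (sw_naturality (neg Y) (pos X) τ₁),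
              reassoc_of% (cupHead_sw γ (pos X)), ← reassoc_of% (capHead_naturality β τ₁),
              reassoc_of% (cons_cupHead_capHead β γ)]
          rw [e]
          exact (hf.plusHead _ hσ₁).perm (hτ₁.trans hρ')
        | move σ' τ' hσ' hτ' =>
          have e : (f ≫ cupHead γ W) ≫ (cons (neg U) (cons (pos V) σ₁ ≫ sw (pos V) (pos X) _ ≫
              cons (pos X) τ₁) ≫ sw (neg U) (pos X) _ ≫ cons (pos X) (cons (neg U) σ' ≫
                sw (neg U) (neg Y) _ ≫ cons (neg Y) τ')) ≫ BrauerEnvelope.capHead β B =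
              f ≫ σ₁ ≫ cons (pos X) (cupHead γ _ ≫ cons (neg U) (τ₁ ≫ σ') ≫
                sw (neg U) (neg Y) _ ≫ cons (neg Y) τ') ≫ BrauerEnvelope.capHead β B := by
            simp only [Category.assoc, cons_comp]
            rw [← reassoc_of% (cupHead_naturality γ σ₁),
              ← reassoc_of% (sw_naturality (neg U) (pos X) τ₁), reassoc_of% (cupHead_sw γ (pos X))]
          rw [e]
          -- It remains to separate the positive end of the last arc from the strand that arrives at
          -- `neg Y`; their signs differ, so again only `move` is possible.
          have h' := (hτ₁.trans hσ').headSplit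
          generalize τ₁ ≫ σ' = ρ at h'
          cases h' with
          | move σ₂ τ₂ hσ₂ hτ₂ =>
            have e : f ≫ σ₁ ≫ cons (pos X) (cupHead γ _ ≫ cons (neg U) (cons (pos V) σ₂ ≫
                sw (pos V) (neg Y) _ ≫ cons (neg Y) τ₂) ≫ sw (neg U) (neg Y) _ ≫
                  cons (neg Y) τ') ≫ BrauerEnvelope.capHead β B =
                ((f ≫ (σ₁ ≫ cons (pos X) σ₂) ≫ BrauerEnvelope.capHead β _) ≫ cupHead γ _) ≫
                  cons (neg U) τ₂ ≫ τ' := by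
              have e₁ : cupHead γ _ ≫ cons (neg U) (cons (pos V) σ₂ ≫ sw (pos V) (neg Y) _ ≫
                  cons (neg Y) τ₂) ≫ sw (neg U) (neg Y) _ ≫ cons (neg Y) τ' =
                  σ₂ ≫ cons (neg Y) (cupHead γ _ ≫ cons (neg U) τ₂ ≫ τ') := by
                simp only [Category.assoc, cons_comp]
                rw [← reassoc_of% (cupHead_naturality γ σ₂),
                  ← reassoc_of% (sw_naturality (neg U) (neg Y) τ₂),
                  reassoc_of% (cupHead_sw γ (neg Y))]
              rw [e₁, cons_comp, Category.assoc, ← capHead_naturality]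
              simp only [Category.assoc]
            rw [e]
            exact ((h (hσ₁.trans (hσ₂.cons _))).arc _).perm ((hτ₂.cons _).trans hτ')
  | @perm W W' f ρ hf hρ h =>
    have := h (hρ.trans hπ)
    simpa only [Category.assoc] using this

/-! ### Reduction of every closed diagram to circles. -/

/-- The morphisms composed of elementary ones at the beginning of a sequence and of
transpositions. -/
inductive IsElementary : {S T : List (SignedPoint C)} → (mk S ⟶ mk T) → Prop
  | perm {S T} {f : mk S ⟶ mk T} : IsPerm f → IsElementary f
  | comp {S T U} {f : mk S ⟶ mk T} {g : mk T ⟶ mk U} :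
      IsElementary f → IsElementary g → IsElementary (f ≫ g)
  | plusHead {X Y : C} (β : X ⟶ Y) (W) : IsElementary (plusHead β W)
  | minusHead {X Y : C} (β : X ⟶ Y) (W) : IsElementary (minusHead β W)
  | capHead {X Y : C} (β : X ⟶ Y) (W) : IsElementary (capHead β W)
  | cupHead {X Y : C} (β : X ⟶ Y) (W) : IsElementary (cupHead β W)

namespace IsElementary

variable {S T : List (SignedPoint C)}

theorem comp_isReduced {g : mk S ⟶ mk T} (hg : IsElementary g) {f : mk [] ⟶ mk S}
    (hf : IsReduced f) : IsReduced (f ≫ g) := by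
  induction hg with
  | perm h => exact hf.perm h
  | comp _ _ h h' => rw [← Category.assoc]; exact h' (h hf)
  | plusHead β W => simpa using hf.plusHead β (.refl _)
  | minusHead β W => simpa using hf.minusHead β (.refl _)
  | capHead β W => simpa using hf.capHead β (.refl _)
  | cupHead β W => exact hf.arc β

theorem cons (a : SignedPoint C) {f : mk S ⟶ mk T} (hf : IsElementary f) :
    IsElementary (cons a f) := by
  induction hf with
  | perm h => exact .perm (h.cons a)
  | comp _ _ h h' => rw [cons_comp]; exact h.comp h'
  | plusHead β W =>
    rw [cons_plusHead]; exact (perm (.swap _ _ _)).comp ((plusHead _ _).comp (perm (.swap _ _ _)))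
  | minusHead β W =>
    rw [cons_minusHead]
    exact (perm (.swap _ _ _)).comp ((minusHead _ _).comp (perm (.swap _ _ _)))
  | capHead β W =>
    rw [cons_capHead]
    exact (perm (.swap _ _ _)).comp ((perm ((IsPerm.swap _ _ _).cons _)).comp (capHead _ _))
  | cupHead β W =>
    rw [← cupHead_sw]
    exact (cupHead _ _).comp ((perm ((IsPerm.swap _ _ _).cons _)).comp (perm (.swap _ _ _)))

theorem id_tensor (U : List (SignedPoint C)) {f : mk S ⟶ mk T} (hf : IsElementary f) :
    IsElementary (𝟙 (mk U) ⊗ₘ f : mk (U ++ S) ⟶ mk (U ++ T)) := by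
  induction U with
  | nil => rw [nil_tensor]; exact hf
  | cons a U ih => rw [← cons_tensor_id]; exact ih.cons a

theorem eqToHom_comp_comp {S' T' : List (SignedPoint C)} (hS : S' = S) (hT : T = T')
    {f : mk S ⟶ mk T} (hf : IsElementary f) :
    IsElementary (eqToHom (congrArg mk hS) ≫ f ≫ eqToHom (congrArg mk hT)) := by
  subst hS hT
  simpa using hf

/-- The idle tail `W` is kept arbitrary for tensor products: `f ⊗ g` is `f` with an enlarged tail,
followed by `g` carried under the target of `f`. -/
theorem head_ofDiag (f : Diag C S T) (W : List (SignedPoint C)) :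
    IsElementary (head (ofDiag f) W) := by
  induction f generalizing W with
  | id S => exact (congrArg IsElementary (head_id S W)).mpr (.perm (.refl _))
  | comp f g hf hg => rw [ofDiag_comp, head_comp]; exact (hf W).comp (hg W)
  | @tensor S T S' T' f g hf hg =>
    have h := ofDiag_sound (Rel.tensor_assoc f g (.id W))
    rw [ofDiag_comp, ofDiag_comp, ofDiag_ofEq, ofDiag_ofEq] at h
    have h' := congrArg (· ≫ eqToHom (congrArg mk (List.append_assoc T T' W).symm)) h
    simp only [Category.assoc, eqToHom_trans, eqToHom_refl, Category.comp_id] at h'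
    refine (congrArg IsElementary h').mpr
      (eqToHom_comp_comp (List.append_assoc S S' W) (List.append_assoc T T' W).symm ?_)
    have e : (ofDiag (f.tensor (g.tensor (.id W))) : mk (S ++ (S' ++ W)) ⟶ mk (T ++ (T' ++ W))) =
        head (ofDiag f) (S' ++ W) ≫ (𝟙 (mk T) ⊗ₘ head (ofDiag g) W :) := by
      refine Eq.trans ?_ (tensorHom_comp_tensorHom (ofDiag f) (𝟙 (mk (S' ++ W))) (𝟙 (mk T))
        (head (ofDiag g) W)).symm
      rw [Category.comp_id, Category.id_comp]; rfl
    rw [e]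
    exact (hf _).comp ((hg W).id_tensor T)
  | plus β => exact plusHead β W
  | minus β => exact minusHead β W
  | cap β => exact capHead β W
  | cup β => exact cupHead β W
  | swap a b => exact perm (.swap a b W)

end IsElementary

/-- The Eckmann–Hilton argument. -/
theorem disjointUnion_eq (f g : mk [] ⟶ (mk [] : BrauerEnvelope C)) :
    disjointUnion f g = f ≫ g := by
  have h : (f ⊗ₘ g : mk [] ⟶ mk []) = f ≫ g := by
    have h1 := head_naturality f g
    rw [nil_tensor] at h1
    have h2 : head f [] = f := (tensor_nil f).trans (by simp)
    rw [h2] at h1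
    have h3 := tensorHom_comp_tensorHom f (𝟙 (mk [])) (𝟙 (mk [])) g
    rw [Category.comp_id, Category.id_comp] at h3
    rw [nil_tensor] at h3
    exact h3.symm.trans (congrArg (· ≫ g) h2)
  refine Eq.trans ?_ h
  exact (Category.id_comp _).trans (Category.comp_id _)

/-- With empty target the last step is not a cup, and a permutation there is trivial, so only
circles peel off. -/
theorem IsReduced.exists_circles {W : List (SignedPoint C)} {f : mk [] ⟶ mk W} (hf : IsReduced f)
    (hW : W = []) : ∃ l, f ≫ eqToHom (congrArg mk hW) = circles l := by
  induction hf with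
  | nil => exact ⟨[], by rw [eqToHom_refl, Category.comp_id]; rfl⟩
  | @loop W f X β hf h =>
    subst hW
    obtain ⟨l, hl⟩ := h rfl
    refine ⟨⟨X, β.toPath⟩ :: l, ?_⟩
    rw [eqToHom_refl, Category.comp_id] at hl ⊢
    have h2 : loopHead β [] = (circle X β.toPath : mk [] ⟶ mk []) :=
      (tensor_nil _).trans (by simp)
    rw [circles, ← hl, disjointUnion_eq, ← h2]
    exact (loopHead_naturality β f).symm ▸ rfl
  | arc => simp at hW
  | perm hf hπ h =>
    have h0 := List.eq_nil_of_length_eq_zero (hπ.length_eq.trans (by rw [hW]; rfl))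
    obtain ⟨l, hl⟩ := h h0
    exact ⟨l, by rw [hπ.eq_id h0 hW, Category.assoc, eqToHom_trans, hl]⟩

/-- Every closed diagram is a disjoint union of circles. -/
theorem exists_eq_circles (f : End (𝟙_ (BrauerEnvelope C))) : ∃ l, f = circles l := by
  induction f using Quotient.inductionOn with | _ d
  obtain ⟨l, hl⟩ := ((IsElementary.head_ofDiag d []).comp_isReduced .nil).exists_circles rfl
  refine ⟨l, Eq.trans ?_ hl⟩
  have h : head (ofDiag d) [] = ofDiag d := (tensor_nil _).trans (by simp)
  rw [Category.id_comp, h, eqToHom_refl, Category.comp_id]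
  rfl

end BrauerEnvelope

/-! ### Circles depend only on loop classes; the isomorphism. -/

namespace BrauerEnvelope

open SignedPoint BrauerEnv

variable {C : Type u} [Category.{v} C]

theorem loopHead_nil {X : C} (β : X ⟶ X) :
    loopHead β [] = (circle X β.toPath : mk [] ⟶ mk []) :=
  (tensor_nil _).trans (by simp)

/-- The decoration `β` slides along the circle: off the cup as a negative strand, through the
crossing, onto the cap. -/
theorem circle_comp_comm {X Y : C} (β : X ⟶ Y) (γ : Y ⟶ X) :
    circle X (β ≫ γ).toPath = circle Y (γ ≫ β).toPath := by
  have h : minusHead β [pos Y] ≫ sw (neg X) (pos Y) [] =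
      sw (neg Y) (pos Y) [] ≫ cons (pos Y) (minusHead β []) := by
    rw [cons_minusHead, ← Category.assoc, sw_sw, Category.id_comp]
  refine (loopHead_nil _).symm.trans (Eq.trans ?_ (loopHead_nil _))
  rw [← head_cup_swap_cap, ← Category.id_comp (γ ≫ β), ← head_cup_swap_cap,
    ← cons_minusHead_capHead, ← Category.assoc (sw _ _ _), ← h, Category.assoc,
    ← Category.assoc (cupHead (𝟙 Y) _), cupHead_minusHead, Category.comp_id]

theorem ofDiag_strand {X Y : C} (p : Quiver.Path X Y) :
    ofDiag (strand p) = ofDiag (Diag.plus (composePath p)) := by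
  induction p with
  | nil => exact (ofDiag_sound (Rel.plus_id X)).symm
  | cons p β ih =>
    rw [strand, ofDiag_comp, ih, ← ofDiag_comp, ofDiag_sound (Rel.plus_comp _ _), composePath_cons]

theorem circle_eq_toPath (X : C) (p : Quiver.Path X X) :
    circle X p = circle X (composePath p).toPath := by
  have h : ofDiag (strand p) = ofDiag (strand (composePath p).toPath) := by
    rw [ofDiag_strand, ofDiag_strand, composePath_toPath]
  exact congrArg (fun f => ofDiag (Diag.cup (𝟙 X)) ≫ cons (neg X) f ≫ ofDiag (capOpposite X)) h

theorem end_mul_comm (f g : End (𝟙_ (BrauerEnvelope C))) : f * g = g * f := by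
  have h := head_naturality (f : mk [] ⟶ mk []) (g : mk [] ⟶ mk [])
  rw [nil_tensor] at h
  have h2 : head f [] = f := (tensor_nil f).trans (by simp)
  rw [h2] at h
  exact h.symm

theorem mul_eq_disjointUnion (f g : End (𝟙_ (BrauerEnvelope C))) : f * g = disjointUnion f g := by
  -- Multiplication in `End` is composition in the reverse order, hence the use of commutativity.
  rw [end_mul_comm]; exact (disjointUnion_eq f g).symm

/-- The circle of a loop. -/
def loopEnd : LoopSet C → End (𝟙_ (BrauerEnvelope C)) :=
  Quot.lift (fun c => circle c.1 (Quiver.Hom.toPath (c.2 : c.1 ⟶ c.1))) (by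
    rintro _ _ ⟨β, γ⟩
    exact circle_comp_comm β γ)

theorem circles_eq_prod (l : List (Σ X : C, Quiver.Path X X)) :
    circles l = (l.map fun c => loopEnd (LoopSet.mk c.1 (composePath c.2))).prod := by
  induction l with
  | nil => rfl
  | cons c l ih =>
    rw [circles, ih, ← mul_eq_disjointUnion, List.map_cons, List.prod_cons, circle_eq_toPath]
    rfl

theorem circles_eq_of_perm {l l' : List (Σ X : C, Quiver.Path X X)}
    (h : (l.map fun c => LoopSet.mk c.1 (composePath c.2)).Perm
      (l'.map fun c => LoopSet.mk c.1 (composePath c.2))) : circles l = circles l' := by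
  have h' := (h.map loopEnd).prod_eq' (by
    rw [List.pairwise_iff_getElem]
    exact fun _ _ _ _ _ => end_mul_comm _ _)
  rw [List.map_map, List.map_map] at h'
  rw [circles_eq_prod, circles_eq_prod]
  exact h'

/-- The multiset of the loops of a closed diagram. -/
noncomputable def loops (f : End (𝟙_ (BrauerEnvelope C))) : Multiset (LoopSet C) :=
  (evalClosed f ⟨fun _ => none, 0⟩).loops

theorem loops_circles (l : List (Σ X : C, Quiver.Path X X)) :
    loops (circles l) = Multiset.ofList (l.map fun c => LoopSet.mk c.1 (composePath c.2)) := by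
  rw [loops, evalClosed_circles]
  exact zero_add _

theorem loops_circle (X : C) (p : Quiver.Path X X) :
    loops (circle X p) = {LoopSet.mk X (composePath p)} := by
  rw [loops, evalClosed_circle]
  exact zero_add _

theorem loops_mul (f g : End (𝟙_ (BrauerEnvelope C))) : loops (f * g) = loops f + loops g := by
  obtain ⟨l, rfl⟩ := exists_eq_circles f
  obtain ⟨l', rfl⟩ := exists_eq_circles g
  rw [loops_circles, loops_circles, loops, mul_eq_disjointUnion, evalClosed_disjointUnion,
    evalClosed_circles, evalClosed_circles]
  exact congrArg (· + _) (zero_add _)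

/-- Both diagrams are unions of circles, and such a union is recovered from the multiset of its
classes. -/
theorem loops_injective : Function.Injective (loops (C := C)) := by
  intro f g h
  obtain ⟨l, rfl⟩ := exists_eq_circles f
  obtain ⟨l', rfl⟩ := exists_eq_circles g
  rw [loops_circles, loops_circles] at h
  exact circles_eq_of_perm (Multiset.coe_eq_coe.1 h)

theorem loops_surjective : Function.Surjective (loops (C := C)) := by
  intro m
  induction m using Multiset.induction_on with
  | empty => exact ⟨circles [], loops_circles []⟩
  | cons a m ih =>
    obtain ⟨f, rfl⟩ := ih
    obtain ⟨⟨X, β⟩, rfl⟩ := Quot.exists_rep a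
    refine ⟨circle X (Quiver.Hom.toPath (β : X ⟶ X)) * f, ?_⟩
    rw [loops_mul, loops_circle, composePath_toPath]
    rfl

/-- The endomorphisms of the unit form the free commutative monoid on the set of loops. -/
noncomputable def endEquiv (C : Type u) [Category.{v} C] :
    End (𝟙_ (BrauerEnvelope C)) ≃* Multiplicative (Multiset (LoopSet C)) :=
  MulEquiv.mk' ((Equiv.ofBijective loops ⟨loops_injective, loops_surjective⟩).trans
    Multiplicative.ofAdd) loops_mul

end BrauerEnvelope

theorem mainTheorem10 (C : Type u) [Category.{v} C] :
    ∃ e : End (𝟙_ (BrauerEnvelope C)) ≃* Multiplicative (Multiset (LoopSet C)),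
      (∀ (X : C) (p : Quiver.Path X X),
        e (BrauerEnvelope.circle X p) = Multiplicative.ofAdd {LoopSet.mk X (composePath p)}) ∧
      (∀ f g : End (𝟙_ (BrauerEnvelope C)), f * g = BrauerEnvelope.disjointUnion f g) ∧
      (1 : End (𝟙_ (BrauerEnvelope C))) = BrauerEnvelope.ofDiag (BrauerEnv.Diag.id []) ∧
      (∀ l : List (Σ X : C, Quiver.Path X X),
        e (BrauerEnvelope.circles l) = Multiplicative.ofAdd
          (Multiset.ofList (l.map fun c => LoopSet.mk c.1 (composePath c.2)))) :=
  ⟨BrauerEnvelope.endEquiv C,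
    fun X p => congrArg Multiplicative.ofAdd (BrauerEnvelope.loops_circle X p),
    BrauerEnvelope.mul_eq_disjointUnion, rfl,
    fun l => congrArg Multiplicative.ofAdd (BrauerEnvelope.loops_circles l)⟩
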